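/- Let $X$ be a Fano manifold of complex dimension $n$ (compact and connected), let $T\simeq (S^1)^r$ be a maximal compact torus in $\mathrm{Aut}(X)$, and let $\xi_1,\dots,\xi_r$ be the holomorphic vector fields generating the factors of $T_{\mathbb C}\simeq(\mathbb C^*)^r$. Let $\omega_0\in 2\pi c_1(X)$ be a $T$-invariant Kähler form with Ricci potential $\rho_0$, i.e. $\mathrm{Ric}(\omega_0)-\omega_0=\sqrt{-1}\,\partial\bar\partial\rho_0$ and $\int_X(e^{\rho_0}-1)\,\omega_0^n=0$. Let $\varphi$ be a smooth real $T$-invariant function with $\omega_\varphi:=\omega_0+\sqrt{-1}\,\partial\bar\partial\varphi>0$, let $\mu_\varphi=(\theta_1,\dots,\theta_r):X\to\mathbb R^r$ be its moment map, i.e. $\iota_{\xi_\alpha}\omega_\varphi=\sqrt{-1}\,\bar\partial\theta_\alpha$ and $\int_X\theta_\alpha\,\omega_\varphi^n=0$ with $\theta_\alpha$ smooth and real, and let $P=\mu_\varphi(X)$ (a convex polytope independent of $\varphi$). Let $g:P\to\mathbb R$ be a smooth, positive, log-concave function and put $g_\varphi:=g\circ\mu_\varphi$, normalized by $\int_X(g_\varphi-1)\,\omega_\varphi^n=0$.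 Define the $g$-twisted Laplacian on smooth complex-valued functions by $$\Delta_{g,\varphi}u=-g_\varphi^{-1}\,\bar\partial^*\bigl(g_\varphi\,\bar\partial u\bigr),$$ where $\bar\partial^*$ is the formal adjoint of $\bar\partial$ with respect to $\omega_\varphi$. Suppose that, for some $t\in(0,1)$, $\varphi$ solves $$g_\varphi\,\omega_\varphi^n=e^{-t\varphi+\rho_0}\,\omega_0^n .$$ Then every non-zero eigenvalue $\lambda$ of $\Delta_{g,\varphi}$ is real and satisfies $\lambda+t<0$. In particular, if $\lambda_1$ denotes the first (largest) non-zero eigenvalue of $\Delta_{g,\varphi}$, then $\lambda_1+t<0$; that is, apart from the eigenvalue $t$ on the constant functions, the first eigenvalue of $\Delta_{g,\varphi}+t$ is negative. -/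

import Mathlib

open scoped Manifold ContDiff ComplexOrder

noncomputable section

namespace GSoliton

/-! ### Local calculus on `ℂⁿ` -/

/-- The Wirtinger derivative `∂F/∂zⁱ` at `y`. -/
def dz {n : ℕ} (F : (Fin n → ℂ) → ℂ) (i : Fin n) (y : Fin n → ℂ) : ℂ :=
  (1 / 2) * (fderiv ℝ F y (Pi.single i 1) - Complex.I * fderiv ℝ F y (Pi.single i Complex.I))

/-- The Wirtinger derivative `∂F/∂z̄ⁱ` at `y`. -/
def dzbar {n : ℕ} (F : (Fin n → ℂ) → ℂ) (i : Fin n) (y : Fin n → ℂ) : ℂ :=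
  (1 / 2) * (fderiv ℝ F y (Pi.single i 1) + Complex.I * fderiv ℝ F y (Pi.single i Complex.I))

/-! ### Functions and forms on a complex manifold -/

/-- Smooth (`C^∞` in the real sense) real valued functions on `X`. -/
def SmoothReal (n : ℕ) {X : Type*} [TopologicalSpace X] [ChartedSpace (Fin n → ℂ) X]
    (f : X → ℝ) : Prop :=
  ContMDiff 𝓘(ℝ, Fin n → ℂ) 𝓘(ℝ, ℝ) ∞ f

/-- Smooth (`C^∞` in the real sense) complex valued functions on `X`. -/
def SmoothComplex (n : ℕ) {X : Type*} [TopologicalSpace X] [ChartedSpace (Fin n → ℂ) X]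
    (f : X → ℂ) : Prop :=
  ContMDiff 𝓘(ℝ, Fin n → ℂ) 𝓘(ℝ, ℂ) ∞ f

/-- The components of a `(1,1)`-form in the holomorphic charts: `h e y i j` is the coefficient
`h_{i j̄}` at the point with coordinates `y` of the form `√-1 ∑ h_{i j̄} dzⁱ ∧ dz̄ʲ` in the
chart `e`. Only the values for `e` in the atlas and `y` in the target of `e` are meaningful. -/
abbrev Form11 (n : ℕ) (X : Type*) [TopologicalSpace X] : Type _ :=
  OpenPartialHomeomorph X (Fin n → ℂ) → (Fin n → ℂ) → Matrix (Fin n) (Fin n) ℂ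

/-- The components `α_{j̄}` of a `(0,1)`-form `∑ α_{j̄} dz̄ʲ` in the holomorphic charts. -/
abbrev Form01 (n : ℕ) (X : Type*) [TopologicalSpace X] : Type _ :=
  OpenPartialHomeomorph X (Fin n → ℂ) → (Fin n → ℂ) → Fin n → ℂ

section Manifold

variable {n : ℕ} {X : Type*} [TopologicalSpace X] [ChartedSpace (Fin n → ℂ) X]

/-- `F^* h = h` for a holomorphic map `F : X → X`, expressed in pairs of charts. For `F = id` it is
the transformation law of the components of a `(1,1)`-form under a change of coordinates. -/
def PreservedBy (F : X → X) (h : Form11 n X) : Prop :=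
  ∀ e ∈ atlas (Fin n → ℂ) X, ∀ e' ∈ atlas (Fin n → ℂ) X, ∀ x ∈ e.source, F x ∈ e'.source →
    ∀ i j : Fin n,
      h e (e x) i j = ∑ k, ∑ l, h e' (e' (F x)) k l
        * fderiv ℂ (fun y => e' (F (e.symm y))) (e x) (Pi.single i 1) k
        * starRingEnd ℂ (fderiv ℂ (fun y => e' (F (e.symm y))) (e x) (Pi.single j 1) l)

/-- Positivity of a real `(1,1)`-form. -/
def IsPositive (h : Form11 n X) : Prop :=
  ∀ e ∈ atlas (Fin n → ℂ) X, ∀ y ∈ e.target, (h e y).PosDef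

/-- `√-1 ∑ h_{i j̄} dzⁱ ∧ dz̄ʲ` is a Kähler form on `X`: a smooth, positive and
closed real `(1,1)`-form. -/
structure IsKahler (h : Form11 n X) : Prop where
  transform : PreservedBy id h
  smooth : ∀ e ∈ atlas (Fin n → ℂ) X, ∀ i j : Fin n, ContDiffOn ℝ ∞ (fun y => h e y i j) e.target
  positive : IsPositive h
  closed : ∀ e ∈ atlas (Fin n → ℂ) X, ∀ y ∈ e.target, ∀ i j k : Fin n,
    dz (fun y' => h e y' i j) k y = dz (fun y' => h e y' k j) i y

/-- The form `√-1 ∂∂̄ f`. -/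
def ddbar (f : X → ℝ) : Form11 n X :=
  fun e y => Matrix.of fun i j => dz (fun y' => dzbar (fun y'' => (f (e.symm y'') : ℂ)) j y') i y

/-- The density of `ωⁿ` with respect to the Lebesgue measure of the chart `e`, for
`ω = √-1 ∑ h_{i j̄} dzⁱ ∧ dz̄ʲ`; recall that `√-1 dz ∧ dz̄ = 2 dx ∧ dy`. -/
def volDensity (h : Form11 n X) (e : OpenPartialHomeomorph X (Fin n → ℂ)) (y : Fin n → ℂ) : ℝ :=
  (n.factorial : ℝ) * 2 ^ n * (h e y).det.re

/-- The measure `ωⁿ` on `X`. For a Kähler form the measures obtained from the charts are the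
restrictions of one measure to the domains of the charts, and that measure is their supremum. -/
def volMeasure [MeasurableSpace X] (h : Form11 n X) : MeasureTheory.Measure X :=
  ⨆ e ∈ atlas (Fin n → ℂ) X, MeasureTheory.Measure.map e.symm
    ((MeasureTheory.volume.restrict e.target).withDensity
      fun y => ENNReal.ofReal (volDensity h e y))

/-- The Ricci form `-√-1 ∂∂̄ log det (h_{i j̄})`. -/
def ricci (h : Form11 n X) : Form11 n X :=
  fun e y => Matrix.of fun i j =>
    -dz (fun y' => dzbar (fun y'' => (Real.log (h e y'').det.re : ℂ)) j y') i y

/-- `ρ` is the Ricci potential of the Kähler form `ω`: `Ric(ω) - ω = √-1 ∂∂̄ ρ` and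
`∫ (e^ρ - 1) ωⁿ = 0`. As `Ric(ω)` represents `2π c₁(X)`, a Kähler form `ω` has a Ricci potential
if and only if `ω ∈ 2π c₁(X)`; then `X` is Fano. -/
structure IsRicciPotential [MeasurableSpace X] (h : Form11 n X) (ρ : X → ℝ) : Prop where
  smooth : SmoothReal n ρ
  eq : ∀ e ∈ atlas (Fin n → ℂ) X, ∀ y ∈ e.target, ricci h e y - h e y = ddbar ρ e y
  normalized : ∫ x, (Real.exp (ρ x) - 1) ∂(volMeasure h) = 0

end Manifold

/-! ### Compact tori of automorphisms and moment maps -/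

/-- A compact torus in `Aut(X)` with an identification with `(S¹)^r`: a faithful continuous action
of `(S¹)^r` on `X` by biholomorphic maps. -/
structure Torus (n r : ℕ) (X : Type*) [TopologicalSpace X] [ChartedSpace (Fin n → ℂ) X] where
  act : (Fin r → Circle) →* Equiv.Perm X
  injective : Function.Injective act
  continuous : Continuous fun p : (Fin r → Circle) × X => act p.1 p.2
  holomorphic : ∀ s, ContMDiff 𝓘(ℂ, Fin n → ℂ) 𝓘(ℂ, Fin n → ℂ) ω (act s)

section Torus

variable {n r : ℕ} {X : Type*} [TopologicalSpace X] [ChartedSpace (Fin n → ℂ) X]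

/-- `T` is not strictly contained in another compact torus of `Aut(X)`. -/
def Torus.IsMaximal (T : Torus n r X) : Prop :=
  ∀ (r' : ℕ) (T' : Torus n r' X), T.act.range ≤ T'.act.range → T'.act.range ≤ T.act.range

/-- The components `ξ_αⁱ` in the chart `e`, at the point `x`, of the holomorphic vector field
`ξ_α = ∑ ξ_αⁱ ∂/∂zⁱ` generating the action of the `α`-th factor of the complexified torus
`(ℂ^*)^r`. As `ξ_α` is the derivative of `c ↦ e^c · x` at `c = 0`, the circle action
`s ↦ e^{√-1 s} · x` has the derivative `√-1 ξ_α`. -/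
def Torus.generator (T : Torus n r X) (α : Fin r) (e : OpenPartialHomeomorph X (Fin n → ℂ))
    (x : X) (i : Fin n) : ℂ :=
  -Complex.I * deriv (fun s : ℝ => e (T.act (Pi.mulSingle α (Circle.exp s)) x) i) 0

/-- `μ = (θ₁, …, θ_r)` is the moment map of the form `ω`: `i_{ξ_α} ω = √-1 ∂̄ θ_α` and
`∫ θ_α ωⁿ = 0` for all `α`. -/
structure IsMomentMap [MeasurableSpace X] (T : Torus n r X) (h : Form11 n X)
    (μ : X → Fin r → ℝ) : Prop where
  smooth : ∀ α, SmoothReal n fun x => μ x α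
  hamilton : ∀ α, ∀ e ∈ atlas (Fin n → ℂ) X, ∀ y ∈ e.target, ∀ j : Fin n,
    ∑ i, h e y i j * T.generator α e (e.symm y) i = dzbar (fun y' => (μ (e.symm y') α : ℂ)) j y
  normalized : ∀ α, ∫ x, μ x α ∂(volMeasure h) = 0

/-- The space `𝓗(X, ω₀)^T` of `T`-invariant Kähler potentials: `ω_φ = ω₀ + √-1 ∂∂̄ φ > 0`. -/
structure IsKahlerPotential (T : Torus n r X) (ω₀ : Form11 n X) (φ : X → ℝ) : Prop where
  smooth : SmoothReal n φ
  positive : IsPositive (ω₀ + ddbar φ)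
  invariant : ∀ s x, φ (T.act s x) = φ x

/-- `g` is a smooth, positive and log concave function on the convex polytope `P`. -/
structure IsWeight (P : Set (Fin r → ℝ)) (g : (Fin r → ℝ) → ℝ) : Prop where
  smooth : ContDiffOn ℝ ∞ g P
  positive : ∀ p ∈ P, 0 < g p
  logConcave : ∀ p ∈ P, ∀ q ∈ P, ∀ a b : ℝ, 0 ≤ a → 0 ≤ b → a + b = 1 →
    g p ^ a * g q ^ b ≤ g (a • p + b • q)

end Torus

section Laplacian

variable {n : ℕ} {X : Type*} [TopologicalSpace X] [ChartedSpace (Fin n → ℂ) X]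

/-- The Monge-Ampère equation `G ω_φⁿ = e^{-tφ+ρ₀} ω₀ⁿ`, an equality of top degree forms; here
`G` stands for `g_φ`. -/
def SolvesContinuityEquation (ω₀ : Form11 n X) (ρ₀ : X → ℝ) (t : ℝ) (G φ : X → ℝ) : Prop :=
  ∀ e ∈ atlas (Fin n → ℂ) X, ∀ x ∈ e.source,
    G x * volDensity (ω₀ + ddbar φ) e (e x)
      = Real.exp (-t * φ x + ρ₀ x) * volDensity ω₀ e (e x)

/-- The `(0,1)`-form `∂̄ u`. -/
def dbar (u : X → ℂ) : Form01 n X :=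
  fun e y j => dzbar (fun y' => u (e.symm y')) j y

/-- The pointwise Hermitian inner product `⟨α, β⟩ = h^{i j̄} α_{j̄} conj(β_{ī})` of `(0,1)`-forms,
where `∑_j h^{i j̄} h_{k j̄} = δ_{ik}`, computed at `x` in the preferred chart. -/
def inner01 (h : Form11 n X) (α β : Form01 n X) (x : X) : ℂ :=
  let e := chartAt (Fin n → ℂ) x
  ∑ i, ∑ j, (h e (e x))⁻¹ j i * α e (e x) j * starRingEnd ℂ (β e (e x) i)

/-- `v = ∂̄^* α`, where `∂̄^*` is the formal adjoint of `∂̄` on functions with respect to the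
`L²` inner products defined by the Kähler form `h`. -/
def IsDbarAdjoint [MeasurableSpace X] (h : Form11 n X) (α : Form01 n X) (v : X → ℂ) : Prop :=
  SmoothComplex n v ∧ ∀ w : X → ℂ, SmoothComplex n w →
    ∫ x, v x * starRingEnd ℂ (w x) ∂(volMeasure h) = ∫ x, inner01 h α (dbar w) x ∂(volMeasure h)

/-- `v = -G⁻¹ ∂̄^*(G ∂̄ u)`, the `G`-twisted Laplacian of `u` with respect to the Kähler form `h`,
for a positive smooth function `G`. -/
def IsTwistedLaplacian [MeasurableSpace X] (h : Form11 n X) (G : X → ℝ) (u v : X → ℂ) : Prop :=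
  IsDbarAdjoint h (fun e y j => (G (e.symm y) : ℂ) * dbar u e y j) (fun x => -(G x : ℂ) * v x)

/-- `c` is an eigenvalue of the `G`-twisted Laplacian on `C^∞(X, ℂ)`. -/
def IsEigenvalue [MeasurableSpace X] (h : Form11 n X) (G : X → ℝ) (c : ℂ) : Prop :=
  ∃ u : X → ℂ, SmoothComplex n u ∧ u ≠ 0 ∧ IsTwistedLaplacian h G u (fun x => c * u x)

end Laplacian

end GSoliton

end

/-! Let `Δu = cu` and `V = grad u`. For the measure `G ω_φⁿ`, the divergence of `∇_{V̄}V` has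
integral zero, and by the Bochner identity it equals `c|V|² + R(V, V̄) + tr(∂̄V · conj ∂̄V)`, where
`R` is `-√-1 ∂∂̄ log (G ω_φⁿ)`. The trace is `|∂̄V|² ≥ 0` because `∂̄V` becomes symmetric when its
vector index is lowered by the metric. The Monge-Ampère equation and `Ric ω₀ = ω₀ + √-1 ∂∂̄ρ₀` give
`R = tω_φ + (1 - t)ω₀ > tω_φ`, so `c + t ≥ 0` forces `V = 0`, hence `c = 0`. -/

open scoped Matrix Topology

noncomputable section

namespace GSoliton

/-! ### Wirtinger calculus -/

section Wirtinger

variable {n : ℕ} {F G : (Fin n → ℂ) → ℂ} {i j : Fin n} {y : Fin n → ℂ}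

theorem dz_congr (hFG : F =ᶠ[𝓝 y] G) : dz F i y = dz G i y := by
  simp only [dz, hFG.fderiv_eq]

theorem dzbar_congr (hFG : F =ᶠ[𝓝 y] G) : dzbar F i y = dzbar G i y := by
  simp only [dzbar, hFG.fderiv_eq]

theorem dz_add (hF : DifferentiableAt ℝ F y) (hG : DifferentiableAt ℝ G y) :
    dz (fun x => F x + G x) i y = dz F i y + dz G i y := by
  simp only [dz, fderiv_fun_add hF hG, _root_.add_apply]
  ring

theorem dzbar_add (hF : DifferentiableAt ℝ F y) (hG : DifferentiableAt ℝ G y) :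
    dzbar (fun x => F x + G x) i y = dzbar F i y + dzbar G i y := by
  simp only [dzbar, fderiv_fun_add hF hG, _root_.add_apply]
  ring

theorem dz_const_mul (c : ℂ) (hF : DifferentiableAt ℝ F y) :
    dz (fun x => c * F x) i y = c * dz F i y := by
  simp only [dz, fderiv_const_mul hF, _root_.smul_apply, smul_eq_mul]
  ring

theorem dzbar_const_mul (c : ℂ) (hF : DifferentiableAt ℝ F y) :
    dzbar (fun x => c * F x) i y = c * dzbar F i y := by
  simp only [dzbar, fderiv_const_mul hF, _root_.smul_apply, smul_eq_mul]
  ring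

theorem dz_mul (hF : DifferentiableAt ℝ F y) (hG : DifferentiableAt ℝ G y) :
    dz (fun x => F x * G x) i y = dz F i y * G y + F y * dz G i y := by
  simp only [dz, fderiv_fun_mul hF hG, _root_.add_apply, _root_.smul_apply, smul_eq_mul]
  ring

theorem dzbar_mul (hF : DifferentiableAt ℝ F y) (hG : DifferentiableAt ℝ G y) :
    dzbar (fun x => F x * G x) i y = dzbar F i y * G y + F y * dzbar G i y := by
  simp only [dzbar, fderiv_fun_mul hF hG, _root_.add_apply, _root_.smul_apply, smul_eq_mul]
  ring

theorem dz_sum {ι : Type*} {s : Finset ι} {f : ι → (Fin n → ℂ) → ℂ}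
    (hf : ∀ k ∈ s, DifferentiableAt ℝ (f k) y) :
    dz (fun x => ∑ k ∈ s, f k x) i y = ∑ k ∈ s, dz (f k) i y := by
  simp only [dz, fderiv_fun_sum hf, _root_.sum_apply, Finset.mul_sum, ← Finset.sum_sub_distrib]

theorem dzbar_sum {ι : Type*} {s : Finset ι} {f : ι → (Fin n → ℂ) → ℂ}
    (hf : ∀ k ∈ s, DifferentiableAt ℝ (f k) y) :
    dzbar (fun x => ∑ k ∈ s, f k x) i y = ∑ k ∈ s, dzbar (f k) i y := by
  simp only [dzbar, fderiv_fun_sum hf, _root_.sum_apply, Finset.mul_sum, ← Finset.sum_add_distrib]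

theorem fderiv_conj_apply (v : Fin n → ℂ) :
    fderiv ℝ (fun x => starRingEnd ℂ (F x)) y v = starRingEnd ℂ (fderiv ℝ F y v) := by
  have h : (fun x => starRingEnd ℂ (F x)) = Complex.conjCLE ∘ F := by ext x; simp
  rw [h, Complex.conjCLE.comp_fderiv]
  simp

theorem dz_conj : dz (fun x => starRingEnd ℂ (F x)) i y = starRingEnd ℂ (dzbar F i y) := by
  simp only [dz, dzbar, fderiv_conj_apply, map_mul, map_add, Complex.conj_I, map_div₀, map_one,
    map_ofNat]
  ring

theorem dzbar_conj : dzbar (fun x => starRingEnd ℂ (F x)) i y = starRingEnd ℂ (dz F i y) := by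
  simp only [dz, dzbar, fderiv_conj_apply, map_mul, map_sub, Complex.conj_I, map_div₀, map_one,
    map_ofNat]
  ring

theorem fderiv_eq_sum_dz_dzbar (F : (Fin n → ℂ) → ℂ) (y v : Fin n → ℂ) :
    fderiv ℝ F y v = ∑ k, (dz F k y * v k + dzbar F k y * starRingEnd ℂ (v k)) := by
  have hv : v = ∑ k, ((v k).re • (Pi.single k 1 : Fin n → ℂ)
      + (v k).im • (Pi.single k Complex.I : Fin n → ℂ)) := by
    ext l
    simp [Pi.single_apply, Finset.sum_add_distrib, Complex.re_add_im]
  conv_lhs => rw [hv, map_sum]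
  refine Finset.sum_congr rfl fun k _ => ?_
  conv_rhs => rw [← Complex.re_add_im (v k)]
  simp only [map_add, map_smul, dz, dzbar, Complex.real_smul, map_mul, Complex.conj_ofReal,
    Complex.conj_I]
  linear_combination (fderiv ℝ F y (Pi.single k Complex.I) * (v k).im) * Complex.I_mul_I

theorem single_I (i : Fin n) : (Pi.single i Complex.I : Fin n → ℂ) = Complex.I • Pi.single i 1 := by
  rw [← Pi.single_smul, smul_eq_mul, mul_one]

theorem dzbar_eq_zero_of_differentiableAt (hF : DifferentiableAt ℂ F y) : dzbar F i y = 0 := by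
  simp only [dzbar, hF.fderiv_restrictScalars ℝ, ContinuousLinearMap.coe_restrictScalars',
    single_I, map_smul, smul_eq_mul]
  linear_combination (1 / 2 * fderiv ℂ F y (Pi.single i 1)) * Complex.I_mul_I

/-- The complex Jacobian matrix `∂τᵏ/∂zⁱ`. -/
def jacobian (τ : (Fin n → ℂ) → (Fin n → ℂ)) (y : Fin n → ℂ) : Matrix (Fin n) (Fin n) ℂ :=
  LinearMap.toMatrix' (fderiv ℂ τ y : (Fin n → ℂ) →ₗ[ℂ] (Fin n → ℂ))

section Chain

variable {τ : (Fin n → ℂ) → (Fin n → ℂ)}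

theorem jacobian_apply (k : Fin n) :
    jacobian τ y k i = fderiv ℂ τ y (Pi.single i 1) k := by
  simp [jacobian, LinearMap.toMatrix'_apply]

theorem differentiableAt_jacobian (hτ : ContDiffAt ℂ 2 τ y) (k i : Fin n) :
    DifferentiableAt ℂ (fun x => jacobian τ x k i) y := by
  simp only [jacobian_apply]
  have hfderiv := (hτ.fderiv_right (m := 1) one_add_one_eq_two.le).differentiableAt one_ne_zero
  exact differentiableAt_pi.1 (hfderiv.clm_apply (differentiableAt_const _)) k

theorem fderiv_comp_holomorphic (hF : DifferentiableAt ℝ F (τ y)) (hτ : DifferentiableAt ℂ τ y)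
    (v : Fin n → ℂ) :
    fderiv ℝ (fun x => F (τ x)) y v = fderiv ℝ F (τ y) (fderiv ℂ τ y v) := by
  rw [fderiv_fun_comp y hF (hτ.restrictScalars ℝ), hτ.fderiv_restrictScalars ℝ]
  rfl

theorem dz_comp_holomorphic (hF : DifferentiableAt ℝ F (τ y)) (hτ : DifferentiableAt ℂ τ y) :
    dz (fun x => F (τ x)) i y = ∑ k, dz F k (τ y) * jacobian τ y k i := by
  rw [dz]
  simp only [jacobian_apply, fderiv_comp_holomorphic hF hτ, single_I, map_smul,
    fderiv_eq_sum_dz_dzbar F (τ y), Finset.mul_sum, ← Finset.sum_sub_distrib]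
  refine Finset.sum_congr rfl fun k _ => ?_
  simp only [Pi.smul_apply, smul_eq_mul, map_mul, Complex.conj_I]
  linear_combination (-1 / 2 * (dz F k (τ y) * fderiv ℂ τ y (Pi.single i 1) k - dzbar F k (τ y)
    * starRingEnd ℂ (fderiv ℂ τ y (Pi.single i 1) k))) * Complex.I_mul_I

theorem dzbar_comp_holomorphic (hF : DifferentiableAt ℝ F (τ y)) (hτ : DifferentiableAt ℂ τ y) :
    dzbar (fun x => F (τ x)) i y
      = ∑ k, dzbar F k (τ y) * starRingEnd ℂ (jacobian τ y k i) := by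
  rw [dzbar]
  simp only [jacobian_apply, fderiv_comp_holomorphic hF hτ, single_I, map_smul,
    fderiv_eq_sum_dz_dzbar F (τ y), Finset.mul_sum, ← Finset.sum_add_distrib]
  refine Finset.sum_congr rfl fun k _ => ?_
  simp only [Pi.smul_apply, smul_eq_mul, map_mul, Complex.conj_I]
  linear_combination (1 / 2 * (dz F k (τ y) * fderiv ℂ τ y (Pi.single i 1) k - dzbar F k (τ y)
    * starRingEnd ℂ (fderiv ℂ τ y (Pi.single i 1) k))) * Complex.I_mul_I

end Chain

theorem dz_exp (hF : DifferentiableAt ℝ F y) :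
    dz (fun x => Complex.exp (F x)) i y = Complex.exp (F y) * dz F i y := by
  simp only [dz, hF.hasFDerivAt.cexp.fderiv, _root_.smul_apply, smul_eq_mul]
  ring

section Smooth

variable {k m : WithTop ℕ∞}

theorem contDiffAt_fderiv_apply (hF : ContDiffAt ℝ m F y) (hkm : k + 1 ≤ m) (v : Fin n → ℂ) :
    ContDiffAt ℝ k (fun x => fderiv ℝ F x v) y :=
  (hF.fderiv_right hkm).clm_apply contDiffAt_const

theorem contDiffAt_dz (hF : ContDiffAt ℝ m F y) (hkm : k + 1 ≤ m) (i : Fin n) :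
    ContDiffAt ℝ k (dz F i) y :=
  contDiffAt_const.mul ((contDiffAt_fderiv_apply hF hkm _).sub
    (contDiffAt_const.mul (contDiffAt_fderiv_apply hF hkm _)))

theorem contDiffAt_dzbar (hF : ContDiffAt ℝ m F y) (hkm : k + 1 ≤ m) (i : Fin n) :
    ContDiffAt ℝ k (dzbar F i) y :=
  contDiffAt_const.mul ((contDiffAt_fderiv_apply hF hkm _).add
    (contDiffAt_const.mul (contDiffAt_fderiv_apply hF hkm _)))

theorem contDiffAt_conj (hF : ContDiffAt ℝ m F y) :
    ContDiffAt ℝ m (fun x => starRingEnd ℂ (F x)) y :=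
  Complex.conjCLE.contDiff.contDiffAt.comp y hF

theorem contDiffAt_ofReal {f : (Fin n → ℂ) → ℝ} (hf : ContDiffAt ℝ m f y) :
    ContDiffAt ℝ m (fun x => (f x : ℂ)) y :=
  Complex.ofRealCLM.contDiff.contDiffAt.comp y hf

theorem fderiv_fderiv_apply (hF : ContDiffAt ℝ 2 F y) (v w : Fin n → ℂ) :
    fderiv ℝ (fun x => fderiv ℝ F x v) y w = fderiv ℝ (fderiv ℝ F) y w v := by
  have hd : DifferentiableAt ℝ (fderiv ℝ F) y :=
    (hF.fderiv_right (m := 1) one_add_one_eq_two.le).differentiableAt one_ne_zero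
  rw [fderiv_clm_apply hd (differentiableAt_const v)]
  simp

theorem fderiv_fderiv_comm (hF : ContDiffAt ℝ 2 F y) (v w : Fin n → ℂ) :
    fderiv ℝ (fderiv ℝ F) y v w = fderiv ℝ (fderiv ℝ F) y w v :=
  (hF.isSymmSndFDerivAt (by rw [minSmoothness_of_isRCLikeNormedField])).eq v w

theorem fderiv_dz_apply (hF : ContDiffAt ℝ 2 F y) (v : Fin n → ℂ) :
    fderiv ℝ (dz F i) y v = (1 / 2) * (fderiv ℝ (fderiv ℝ F) y v (Pi.single i 1)
      - Complex.I * fderiv ℝ (fderiv ℝ F) y v (Pi.single i Complex.I)) := by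
  have h (w : Fin n → ℂ) : DifferentiableAt ℝ (fun x => fderiv ℝ F x w) y :=
    (contDiffAt_fderiv_apply hF one_add_one_eq_two.le w).differentiableAt one_ne_zero
  unfold dz
  rw [fderiv_const_mul ((h _).fun_sub ((h _).const_mul _)),
    fderiv_fun_sub (h _) ((h _).const_mul _), fderiv_const_mul (h _)]
  simp [fderiv_fderiv_apply hF]

theorem fderiv_dzbar_apply (hF : ContDiffAt ℝ 2 F y) (v : Fin n → ℂ) :
    fderiv ℝ (dzbar F i) y v = (1 / 2) * (fderiv ℝ (fderiv ℝ F) y v (Pi.single i 1)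
      + Complex.I * fderiv ℝ (fderiv ℝ F) y v (Pi.single i Complex.I)) := by
  have h (w : Fin n → ℂ) : DifferentiableAt ℝ (fun x => fderiv ℝ F x w) y :=
    (contDiffAt_fderiv_apply hF one_add_one_eq_two.le w).differentiableAt one_ne_zero
  unfold dzbar
  rw [fderiv_const_mul ((h _).fun_add ((h _).const_mul _)),
    fderiv_fun_add (h _) ((h _).const_mul _), fderiv_const_mul (h _)]
  simp [fderiv_fderiv_apply hF, mul_add]

theorem dz_dzbar_comm (hF : ContDiffAt ℝ 2 F y) : dz (dzbar F j) i y = dzbar (dz F i) j y := by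
  rw [dz, dzbar]
  simp only [fderiv_dzbar_apply hF, fderiv_dz_apply hF, fderiv_fderiv_comm hF (Pi.single j _)]
  ring

theorem dz_dz_comm (hF : ContDiffAt ℝ 2 F y) : dz (dz F j) i y = dz (dz F i) j y := by
  rw [dz, dz]
  simp only [fderiv_dz_apply hF, fderiv_fderiv_comm hF (Pi.single j _)]
  ring

theorem dzbar_dzbar_comm (hF : ContDiffAt ℝ 2 F y) :
    dzbar (dzbar F j) i y = dzbar (dzbar F i) j y := by
  rw [dzbar, dzbar]
  simp only [fderiv_dzbar_apply hF, fderiv_fderiv_comm hF (Pi.single j _)]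
  ring

end Smooth

end Wirtinger

/-! ### The Bochner identity in coordinates -/

section Bochner

variable {n : ℕ} {y : Fin n → ℂ}

/-- The complex Hessian `∂²F/∂zⁱ∂z̄ʲ`, the matrix of `√-1 ∂∂̄F`. -/
def complexHessian (F : (Fin n → ℂ) → ℂ) (y : Fin n → ℂ) : Matrix (Fin n) (Fin n) ℂ :=
  Matrix.of fun i j => dz (dzbar F j) i y

/-- The matrix `∂Vˡ/∂z̄ʲ` of `∂̄V`, for a vector field `V = ∑ Vˡ ∂/∂zˡ`. -/
def dbarMatrix (V : (Fin n → ℂ) → Fin n → ℂ) (y : Fin n → ℂ) : Matrix (Fin n) (Fin n) ℂ :=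
  Matrix.of fun l j => dzbar (fun x => V x l) j y

/-- The derivative `∇_{V̄} V` of the vector field `V = ∑ Vˡ ∂/∂zˡ` in the direction of its
conjugate; as it only involves `∂̄V`, it is again a vector field of type `(1,0)`. -/
def conjDeriv (V : (Fin n → ℂ) → Fin n → ℂ) (y : Fin n → ℂ) : Fin n → ℂ :=
  dbarMatrix V y *ᵥ star (V y)

/-- The divergence of `V = ∑ Vˡ ∂/∂zˡ` with respect to the density `e^Φ`. -/
def weightedDiv (Φ : (Fin n → ℂ) → ℂ) (V : (Fin n → ℂ) → Fin n → ℂ) (y : Fin n → ℂ) : ℂ :=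
  ∑ l, (dz (fun x => V x l) l y + dz Φ l y * V y l)

section Hessian

variable {F G : (Fin n → ℂ) → ℂ}

theorem complexHessian_congr (hFG : F =ᶠ[𝓝 y] G) :
    complexHessian F y = complexHessian G y := by
  ext i j
  exact dz_congr (hFG.eventually_nhds.mono fun x hx => dzbar_congr hx)

theorem complexHessian_add (hF : ContDiffAt ℝ 2 F y) (hG : ContDiffAt ℝ 2 G y) :
    complexHessian (fun x => F x + G x) y = complexHessian F y + complexHessian G y := by
  have hd {H : (Fin n → ℂ) → ℂ} (hH : ContDiffAt ℝ 2 H y) (j : Fin n) :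
      DifferentiableAt ℝ (dzbar H j) y :=
    (contDiffAt_dzbar hH one_add_one_eq_two.le j).differentiableAt one_ne_zero
  ext i j
  have h : dzbar (fun x => F x + G x) j =ᶠ[𝓝 y] fun x => dzbar F j x + dzbar G j x := by
    filter_upwards [hF.eventually (by simp), hG.eventually (by simp)] with x hFx hGx
    exact dzbar_add (hFx.differentiableAt two_ne_zero) (hGx.differentiableAt two_ne_zero)
  exact (dz_congr h).trans (dz_add (hd hF j) (hd hG j))

theorem complexHessian_const_add (c : ℂ) :
    complexHessian (fun x => c + F x) y = complexHessian F y := by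
  ext i j
  have h : dzbar (fun x => c + F x) j = dzbar F j := by
    funext x
    simp only [dzbar, fderiv_const_add]
  simp only [complexHessian, Matrix.of_apply, h]

theorem complexHessian_const_mul (c : ℂ) (hF : ContDiffAt ℝ 2 F y) :
    complexHessian (fun x => c * F x) y = c • complexHessian F y := by
  ext i j
  have h : dzbar (fun x => c * F x) j =ᶠ[𝓝 y] fun x => c * dzbar F j x := by
    filter_upwards [hF.eventually (by simp)] with x hFx
    exact dzbar_const_mul c (hFx.differentiableAt two_ne_zero)
  exact (dz_congr h).trans (dz_const_mul c
    ((contDiffAt_dzbar hF one_add_one_eq_two.le j).differentiableAt one_ne_zero))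

theorem complexHessian_comp_holomorphic {τ : (Fin n → ℂ) → (Fin n → ℂ)}
    (hF : ContDiffAt ℝ 2 F (τ y)) (hτ : ContDiffAt ℂ 2 τ y) :
    complexHessian (fun x => F (τ x)) y
      = (jacobian τ y)ᵀ * complexHessian F (τ y) * (jacobian τ y).map (starRingEnd ℂ) := by
  have hτ' : DifferentiableAt ℂ τ y := hτ.differentiableAt two_ne_zero
  have hd (l : Fin n) : DifferentiableAt ℝ (dzbar F l) (τ y) :=
    (contDiffAt_dzbar hF one_add_one_eq_two.le l).differentiableAt one_ne_zero
  have hdτ (l : Fin n) : DifferentiableAt ℝ (fun x => dzbar F l (τ x)) y :=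
    DifferentiableAt.comp (g := dzbar F l) y (hd l) (hτ'.restrictScalars ℝ)
  have hJ (l j : Fin n) : DifferentiableAt ℝ (fun x => starRingEnd ℂ (jacobian τ x l j)) y :=
    Complex.conjCLE.differentiableAt.comp y
      ((differentiableAt_jacobian hτ l j).restrictScalars ℝ)
  have hchain (j : Fin n) : dzbar (fun x => F (τ x)) j =ᶠ[𝓝 y]
      fun x => ∑ l, dzbar F l (τ x) * starRingEnd ℂ (jacobian τ x l j) := by
    filter_upwards [hτ'.continuousAt.eventually (hF.eventually (by simp)),
      hτ.eventually (by simp)] with x hFx hτx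
    exact dzbar_comp_holomorphic (hFx.differentiableAt two_ne_zero)
      (hτx.differentiableAt two_ne_zero)
  ext i j
  simp only [complexHessian, Matrix.of_apply, Matrix.mul_apply, Matrix.transpose_apply,
    Matrix.map_apply]
  rw [dz_congr (hchain j), dz_sum fun l _ => (hdτ l).fun_mul (hJ l j)]
  refine Finset.sum_congr rfl fun l _ => ?_
  rw [dz_mul (hdτ l) (hJ l j), dz_conj,
    dzbar_eq_zero_of_differentiableAt (differentiableAt_jacobian hτ l j), map_zero, mul_zero,
    add_zero, dz_comp_holomorphic (hd l) hτ']
  simp only [mul_comm (jacobian τ y _ i)]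

end Hessian

section Divergence

variable {Φ : (Fin n → ℂ) → ℂ} {V : (Fin n → ℂ) → Fin n → ℂ} {k m : WithTop ℕ∞}

theorem conjDeriv_apply (l : Fin n) :
    conjDeriv V y l = ∑ j, dbarMatrix V y l j * star (V y j) := rfl

theorem contDiffAt_conjDeriv (hV : ContDiffAt ℝ m V y) (hkm : k + 1 ≤ m) :
    ContDiffAt ℝ k (conjDeriv V) y := by
  refine contDiffAt_pi.2 fun l => ?_
  simp only [conjDeriv_apply]
  exact ContDiffAt.sum fun j _ => (contDiffAt_dzbar (contDiffAt_pi.1 hV l) hkm j).mul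
    (contDiffAt_conj (contDiffAt_pi.1 (hV.of_le (le_self_add.trans hkm)) j))

theorem contDiffAt_weightedDiv (hΦ : ContDiffAt ℝ m Φ y) (hV : ContDiffAt ℝ m V y)
    (hkm : k + 1 ≤ m) : ContDiffAt ℝ k (weightedDiv Φ V) y :=
  ContDiffAt.sum fun l _ => (contDiffAt_dz (contDiffAt_pi.1 hV l) hkm l).add
    ((contDiffAt_dz hΦ hkm l).mul (contDiffAt_pi.1 (hV.of_le (le_self_add.trans hkm)) l))

theorem dzbar_weightedDiv (hΦ : ContDiffAt ℝ 2 Φ y) (hV : ContDiffAt ℝ 2 V y) (j : Fin n) :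
    dzbar (weightedDiv Φ V) j y = ∑ l, (dz (fun x => dbarMatrix V x l j) l y
      + (complexHessian Φ y l j * V y l + dz Φ l y * dbarMatrix V y l j)) := by
  have hd (l : Fin n) : DifferentiableAt ℝ (fun x => V x l) y :=
    (contDiffAt_pi.1 hV l).differentiableAt two_ne_zero
  have hdz {F : (Fin n → ℂ) → ℂ} (hF : ContDiffAt ℝ 2 F y) (l : Fin n) :
      DifferentiableAt ℝ (dz F l) y :=
    (contDiffAt_dz hF one_add_one_eq_two.le l).differentiableAt one_ne_zero
  have hdV (l : Fin n) := hdz (contDiffAt_pi.1 hV l) l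
  unfold weightedDiv
  rw [dzbar_sum fun l _ => (hdV l).fun_add ((hdz hΦ l).fun_mul (hd l))]
  refine Finset.sum_congr rfl fun l _ => ?_
  rw [dzbar_add (hdV l) ((hdz hΦ l).fun_mul (hd l)), dzbar_mul (hdz hΦ l) (hd l),
    ← dz_dzbar_comm (contDiffAt_pi.1 hV l), ← dz_dzbar_comm hΦ]
  rfl

theorem dz_conjDeriv (hV : ContDiffAt ℝ 2 V y) (l : Fin n) :
    dz (fun x => conjDeriv V x l) l y = ∑ j, (dz (fun x => dbarMatrix V x l j) l y * star (V y j)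
      + dbarMatrix V y l j * star (dbarMatrix V y j l)) := by
  have hc (j : Fin n) : DifferentiableAt ℝ (fun x => star (V x j)) y :=
    (contDiffAt_conj (contDiffAt_pi.1 hV j)).differentiableAt two_ne_zero
  have hB (j : Fin n) : DifferentiableAt ℝ (fun x => dbarMatrix V x l j) y :=
    (contDiffAt_dzbar (contDiffAt_pi.1 hV l) one_add_one_eq_two.le j).differentiableAt one_ne_zero
  simp only [conjDeriv_apply]
  refine (dz_sum fun j _ => (hB j).fun_mul (hc j)).trans (Finset.sum_congr rfl fun j _ => ?_)
  exact (dz_mul (hB j) (hc j)).trans (congrArg _ (congrArg _ dz_conj))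

theorem weightedDiv_conjDeriv (hΦ : ContDiffAt ℝ 2 Φ y) (hV : ContDiffAt ℝ 2 V y) :
    weightedDiv Φ (conjDeriv V) y
      = (fun j => dzbar (weightedDiv Φ V) j y) ⬝ᵥ star (V y)
        - V y ⬝ᵥ (complexHessian Φ y *ᵥ star (V y))
        + (dbarMatrix V y * (dbarMatrix V y).map star).trace := by
  rw [weightedDiv, Finset.sum_add_distrib, Finset.sum_congr rfl fun l _ => dz_conjDeriv hV l,
    ← Finset.sum_add_distrib]
  simp only [dzbar_weightedDiv hΦ hV, dotProduct, conjDeriv_apply, Matrix.mulVec, Matrix.trace,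
    Matrix.diag_apply, Matrix.mul_apply, Matrix.map_apply, Finset.mul_sum, Finset.sum_mul,
    Pi.star_apply]
  rw [Finset.sum_comm (f := fun j l => _ * star (V y j))]
  simp only [← Finset.sum_sub_distrib, ← Finset.sum_add_distrib]
  refine Finset.sum_congr rfl fun l _ => Finset.sum_congr rfl fun j _ => ?_
  ring

end Divergence

open scoped MatrixOrder in
theorem trace_mul_nonneg {A B : Matrix (Fin n) (Fin n) ℂ} (hA : A.PosSemidef)
    (hB : B.PosSemidef) : 0 ≤ (A * B).trace := by
  obtain ⟨K, rfl⟩ := CStarAlgebra.nonneg_iff_eq_star_mul_self.mp hA.nonneg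
  rw [Matrix.mul_assoc, Matrix.trace_mul_comm]
  exact (hB.mul_mul_conjTranspose_same K).trace_nonneg

theorem trace_mul_map_star_nonneg_of_isSymm {h B : Matrix (Fin n) (Fin n) ℂ} (hh : h.PosDef)
    (hB : (hᵀ * B).IsSymm) : 0 ≤ (B * B.map star).trace := by
  have hu : IsUnit h.det := (Matrix.isUnit_iff_isUnit_det _).1 hh.isUnit
  have hut : IsUnit hᵀ.det := by rwa [Matrix.det_transpose]
  have hstar : (hᵀ * B)ᴴ = h * B.map star := by
    rw [Matrix.conjTranspose, hB.eq]
    ext i j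
    simp only [Matrix.map_apply, Matrix.mul_apply, Matrix.transpose_apply, star_sum, star_mul']
    exact Finset.sum_congr rfl fun k _ => congrArg (· * _) (hh.isHermitian.apply i k)
  have hBB : B * B.map star = (h⁻¹)ᵀ * ((hᵀ * B) * h⁻¹ * (hᵀ * B)ᴴ) := by
    rw [hstar, Matrix.transpose_nonsing_inv, Matrix.mul_assoc (hᵀ * B),
      Matrix.nonsing_inv_mul_cancel_left _ _ hu, Matrix.mul_assoc hᵀ,
      Matrix.nonsing_inv_mul_cancel_left _ _ hut]
  rw [hBB]
  exact trace_mul_nonneg hh.inv.transpose.posSemidef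
    (hh.inv.posSemidef.mul_mul_conjTranspose_same _)

end Bochner

/-! ### Integration by parts in coordinates -/

section Integration

open MeasureTheory

theorem contDiff_mul_of_contDiffAt_tsupport {E : Type*} [NormedAddCommGroup E] [NormedSpace ℝ E]
    {m : WithTop ℕ∞} {χ Q : E → ℂ} (hχ : ContDiff ℝ m χ)
    (hQ : ∀ y ∈ tsupport χ, ContDiffAt ℝ m Q y) : ContDiff ℝ m fun y => χ y * Q y := by
  refine contDiff_iff_contDiffAt.2 fun y => ?_
  by_cases hy : y ∈ tsupport χ
  · exact hχ.contDiffAt.mul (hQ y hy)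
  · refine contDiffAt_const (c := (0 : ℂ)) |>.congr_of_eventuallyEq ?_
    filter_upwards [notMem_tsupport_iff_eventuallyEq.1 hy] with x hx
    simp [hx]

variable {n : ℕ} {χ Q Φ : (Fin n → ℂ) → ℂ} {i : Fin n}

theorem integral_fderiv_apply_eq_zero (hχ : ContDiff ℝ 1 χ) (hχc : HasCompactSupport χ)
    (v : Fin n → ℂ) : ∫ y, fderiv ℝ χ y v = 0 := by
  have hint : Integrable fun y => fderiv ℝ χ y v :=
    ((hχ.continuous_fderiv one_ne_zero).clm_apply continuous_const).integrable_of_hasCompactSupport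
      (hχc.fderiv_apply ℝ v)
  have h := integral_mul_fderiv_eq_neg_fderiv_mul_of_integrable (𝕜 := ℂ)
    (μ := (volume : Measure (Fin n → ℂ))) (f := fun _ => (1 : ℂ)) (g := χ) (v := v)
    (by simp) (by simpa using hint)
    (by simpa using hχ.continuous.integrable_of_hasCompactSupport hχc)
    (fun _ _ => differentiableAt_const _) (fun x _ => hχ.differentiable one_ne_zero x)
  simpa using h

theorem integral_dz_eq_zero (hχ : ContDiff ℝ 1 χ) (hχc : HasCompactSupport χ) :
    ∫ y, dz χ i y = 0 := by
  have hint (v : Fin n → ℂ) : Integrable fun y => fderiv ℝ χ y v :=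
    ((hχ.continuous_fderiv one_ne_zero).clm_apply continuous_const).integrable_of_hasCompactSupport
      (hχc.fderiv_apply ℝ v)
  simp only [dz]
  rw [integral_const_mul, integral_sub (hint _) ((hint _).const_mul _), integral_const_mul,
    integral_fderiv_apply_eq_zero hχ hχc, integral_fderiv_apply_eq_zero hχ hχc, mul_zero, sub_zero,
    mul_zero]

theorem tsupport_dz_subset : tsupport (dz χ i) ⊆ tsupport χ := by
  refine closure_minimal (fun y hy => ?_) (isClosed_tsupport χ)
  contrapose! hy
  rw [Function.notMem_support, dz_congr (notMem_tsupport_iff_eventuallyEq.1 hy)]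
  simp [dz]

theorem integrable_mul_of_contDiffAt_tsupport (hχ : ContDiff ℝ ∞ χ) (hχc : HasCompactSupport χ)
    (hQ : ∀ y ∈ tsupport χ, ContDiffAt ℝ 0 Q y) : Integrable fun y => χ y * Q y :=
  (contDiff_mul_of_contDiffAt_tsupport (hχ.of_le (by simp))
    hQ).continuous.integrable_of_hasCompactSupport hχc.mul_right

theorem dz_mul_of_contDiffAt_tsupport (hχ : ContDiff ℝ 1 χ)
    (hQ : ∀ y ∈ tsupport χ, ContDiffAt ℝ 1 Q y) (y : Fin n → ℂ) :
    dz (fun x => χ x * Q x) i y = dz χ i y * Q y + χ y * dz Q i y := by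
  by_cases hy : y ∈ tsupport χ
  · exact dz_mul (hχ.differentiable one_ne_zero y) ((hQ y hy).differentiableAt one_ne_zero)
  · have h0 : χ =ᶠ[𝓝 y] 0 := notMem_tsupport_iff_eventuallyEq.1 hy
    have h0Q : (fun x => χ x * Q x) =ᶠ[𝓝 y] 0 := by
      filter_upwards [h0] with x hx
      simp [hx]
    rw [dz_congr h0, dz_congr h0Q, h0.eq_of_nhds]
    simp [dz]

theorem integrable_dz_mul (hχ : ContDiff ℝ ∞ χ) (hχc : HasCompactSupport χ)
    (hQ : ∀ y ∈ tsupport χ, ContDiffAt ℝ 1 Q y) : Integrable fun y => dz χ i y * Q y :=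
  integrable_mul_of_contDiffAt_tsupport
    (contDiff_iff_contDiffAt.2 fun _ => contDiffAt_dz hχ.contDiffAt (by simp) i)
    (hχc.of_isClosed_subset (isClosed_tsupport _) tsupport_dz_subset)
    fun y hy => (hQ y (tsupport_dz_subset hy)).of_le zero_le_one

theorem integrable_mul_dz (hχ : ContDiff ℝ ∞ χ) (hχc : HasCompactSupport χ)
    (hQ : ∀ y ∈ tsupport χ, ContDiffAt ℝ 1 Q y) : Integrable fun y => χ y * dz Q i y :=
  integrable_mul_of_contDiffAt_tsupport hχ hχc
    fun y hy => contDiffAt_dz (hQ y hy) (by simp) i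

theorem integral_dz_mul_eq_neg (hχ : ContDiff ℝ ∞ χ) (hχc : HasCompactSupport χ)
    (hQ : ∀ y ∈ tsupport χ, ContDiffAt ℝ 1 Q y) :
    ∫ y, dz χ i y * Q y = -∫ y, χ y * dz Q i y := by
  have hχ1 : ContDiff ℝ 1 χ := hχ.of_le (by simp)
  rw [eq_neg_iff_add_eq_zero, ← integral_add (integrable_dz_mul hχ hχc hQ)
    (integrable_mul_dz hχ hχc hQ),
    ← integral_dz_eq_zero (i := i) (contDiff_mul_of_contDiffAt_tsupport hχ1 hQ)
      hχc.mul_right]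
  exact integral_congr_ae (.of_forall fun y => (dz_mul_of_contDiffAt_tsupport hχ1 hQ y).symm)

theorem integral_exp_mul_dotProduct_dz {W : (Fin n → ℂ) → Fin n → ℂ} (hχ : ContDiff ℝ ∞ χ)
    (hχc : HasCompactSupport χ) (hΦ : ∀ y ∈ tsupport χ, ContDiffAt ℝ 1 Φ y)
    (hW : ∀ y ∈ tsupport χ, ContDiffAt ℝ 1 W y) :
    ∫ y, Complex.exp (Φ y) * (W y ⬝ᵥ fun l => dz χ l y)
      = -∫ y, Complex.exp (Φ y) * (χ y * weightedDiv Φ W y) := by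
  have hQ (l : Fin n) : ∀ y ∈ tsupport χ, ContDiffAt ℝ 1 (fun y => Complex.exp (Φ y) * W y l) y :=
    fun y hy => (hΦ y hy).cexp.mul (contDiffAt_pi.1 (hW y hy) l)
  have hdz (y : Fin n → ℂ) : ∑ l, χ y * dz (fun y => Complex.exp (Φ y) * W y l) l y
      = Complex.exp (Φ y) * (χ y * weightedDiv Φ W y) := by
    by_cases hy : y ∈ tsupport χ
    · have hΦy := (hΦ y hy).differentiableAt one_ne_zero
      simp only [weightedDiv, Finset.mul_sum]
      refine Finset.sum_congr rfl fun l _ => ?_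
      rw [dz_mul hΦy.cexp ((contDiffAt_pi.1 (hW y hy) l).differentiableAt one_ne_zero), dz_exp hΦy]
      ring
    · simp [image_eq_zero_of_notMem_tsupport hy]
  calc ∫ y, Complex.exp (Φ y) * (W y ⬝ᵥ fun l => dz χ l y)
      = ∫ y, ∑ l, dz χ l y * (Complex.exp (Φ y) * W y l) := by
        simp only [dotProduct, Finset.mul_sum, ← mul_assoc, mul_comm (dz χ _ _)]
    _ = -∑ l, ∫ y, χ y * dz (fun y => Complex.exp (Φ y) * W y l) l y := by
        rw [integral_finsetSum _ fun l _ => integrable_dz_mul hχ hχc (hQ l),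
          ← Finset.sum_neg_distrib]
        exact Finset.sum_congr rfl fun l _ => integral_dz_mul_eq_neg hχ hχc (hQ l)
    _ = -∫ y, Complex.exp (Φ y) * (χ y * weightedDiv Φ W y) := by
        rw [← integral_finsetSum _ fun l _ => integrable_mul_dz hχ hχc (hQ l)]
        simp only [hdz]

end Integration

/-! ### Changes of holomorphic coordinates -/

section Coordinates

variable {n : ℕ} {X : Type*} [TopologicalSpace X]
  {e e' : OpenPartialHomeomorph X (Fin n → ℂ)} {y : Fin n → ℂ}

theorem mem_target_of_mem_overlap (hy : y ∈ (e.symm ≫ₕ e').source) : y ∈ e.target :=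
  hy.1

theorem symm_mem_source_of_mem_overlap (hy : y ∈ (e.symm ≫ₕ e').source) : e.symm y ∈ e'.source :=
  hy.2

theorem mem_overlap_of_mem_source {x : X} (hx : x ∈ e.source) (hx' : x ∈ e'.source) :
    e x ∈ (e.symm ≫ₕ e').source := by
  simp [hx, hx', e.left_inv hx]

theorem overlap_mem_nhds (hy : y ∈ (e.symm ≫ₕ e').source) : (e.symm ≫ₕ e').source ∈ 𝓝 y :=
  (e.symm ≫ₕ e').open_source.mem_nhds hy

theorem transition_mem_target (hy : y ∈ (e.symm ≫ₕ e').source) :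
    (e.symm ≫ₕ e') y ∈ e'.target :=
  e'.map_source (symm_mem_source_of_mem_overlap (e := e) hy)

theorem symm_transition (hy : y ∈ (e.symm ≫ₕ e').source) :
    e'.symm ((e.symm ≫ₕ e') y) = e.symm y :=
  e'.left_inv (symm_mem_source_of_mem_overlap (e := e) hy)

theorem transition_mem_overlap (hy : y ∈ (e.symm ≫ₕ e').source) :
    (e.symm ≫ₕ e') y ∈ (e'.symm ≫ₕ e).source :=
  mem_overlap_of_mem_source (symm_mem_source_of_mem_overlap (e := e) hy)
    (e.map_target (mem_target_of_mem_overlap hy))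

theorem transition_transition (hy : y ∈ (e.symm ≫ₕ e').source) :
    (e'.symm ≫ₕ e) ((e.symm ≫ₕ e') y) = y :=
  (congrArg e (symm_transition hy)).trans (e.right_inv (mem_target_of_mem_overlap hy))

theorem comp_symm_eventuallyEq {E : Type*} (u : X → E) (hy : y ∈ (e.symm ≫ₕ e').source) :
    (fun y => u (e.symm y)) =ᶠ[𝓝 y] fun y => u (e'.symm ((e.symm ≫ₕ e') y)) := by
  filter_upwards [overlap_mem_nhds hy] with z hz
  rw [symm_transition hz]

variable [ChartedSpace (Fin n → ℂ) X]

theorem preservedBy_id_iff {h : Form11 n X} :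
    PreservedBy id h ↔ ∀ e ∈ atlas (Fin n → ℂ) X, ∀ e' ∈ atlas (Fin n → ℂ) X,
      ∀ y ∈ (e.symm ≫ₕ e').source,
        h e y = (jacobian (e.symm ≫ₕ e') y)ᵀ * h e' ((e.symm ≫ₕ e') y) *
          (jacobian (e.symm ≫ₕ e') y).map (starRingEnd ℂ) := by
  have sum_eq (A B : Matrix (Fin n) (Fin n) ℂ) (i j : Fin n) :
      ∑ k, ∑ l, A k l * B k i * starRingEnd ℂ (B l j)
        = (Bᵀ * A * B.map (starRingEnd ℂ)) i j := by
    simp only [Matrix.mul_apply, Matrix.transpose_apply, Matrix.map_apply, Finset.sum_mul]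
    rw [Finset.sum_comm]
    simp only [mul_comm (A _ _)]
  constructor
  · intro hh e he e' he' y hy
    have hy' := mem_target_of_mem_overlap hy
    ext i j
    have hij := hh e he e' he' (e.symm y) (e.map_target hy') hy.2 i j
    rw [e.right_inv hy'] at hij
    exact hij.trans (sum_eq _ (jacobian (e.symm ≫ₕ e') y) i j)
  · intro hh e he e' he' x hx hx' i j
    rw [hh e he e' he' (e x) (mem_overlap_of_mem_source hx hx'), ← sum_eq,
      OpenPartialHomeomorph.coe_trans, Function.comp_apply, e.left_inv hx]
    rfl

theorem preservedBy_add {F : X → X} {h h' : Form11 n X} (hh : PreservedBy F h)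
    (hh' : PreservedBy F h') : PreservedBy F (h + h') := by
  intro e he e' he' x hx hx' i j
  simp only [Pi.add_apply, Matrix.add_apply]
  rw [hh e he e' he' x hx hx' i j, hh' e he e' he' x hx hx' i j]
  simp only [add_mul, Finset.sum_add_distrib]

theorem smoothComplex_ofReal {f : X → ℝ} (hf : SmoothReal n f) :
    SmoothComplex n fun x => (f x : ℂ) :=
  Complex.ofRealCLM.contDiff.contMDiff.comp hf

theorem smoothComplex_ofReal_mul {f : X → ℝ} {w : X → ℂ} (hf : SmoothReal n f)
    (hw : SmoothComplex n w) : SmoothComplex n fun x => f x * w x :=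
  contDiff_mul.contMDiff.comp ((smoothComplex_ofReal hf).prodMk_space hw)

/-- The components `∂u/∂zⁱ` of the `(1,0)`-form `∂u` in the holomorphic charts. -/
def del (u : X → ℂ) (e : OpenPartialHomeomorph X (Fin n → ℂ)) (y : Fin n → ℂ) : Fin n → ℂ :=
  fun i => dz (fun y' => u (e.symm y')) i y

variable [IsManifold 𝓘(ℂ, Fin n → ℂ) ω X]

theorem contDiffAt_transition (he : e ∈ atlas (Fin n → ℂ) X) (he' : e' ∈ atlas (Fin n → ℂ) X)
    (hy : y ∈ (e.symm ≫ₕ e').source) : ContDiffAt ℂ ω (e.symm ≫ₕ e') y := by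
  have h := (contDiffGroupoid ω 𝓘(ℂ, Fin n → ℂ)).compatible he he'
  rw [contDiffGroupoid, mem_groupoid_of_pregroupoid] at h
  have hon : ContDiffOn ℂ ω (e.symm ≫ₕ e') (e.symm ≫ₕ e').source := by
    simpa [contDiffPregroupoid] using h.1
  exact hon.contDiffAt (overlap_mem_nhds hy)

theorem differentiableAt_transition (he : e ∈ atlas (Fin n → ℂ) X)
    (he' : e' ∈ atlas (Fin n → ℂ) X) (hy : y ∈ (e.symm ≫ₕ e').source) :
    DifferentiableAt ℂ (e.symm ≫ₕ e') y :=
  (contDiffAt_transition he he' hy).differentiableAt (by simp)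

variable (n X) in
theorem isManifold_real : IsManifold 𝓘(ℝ, Fin n → ℂ) ∞ X := by
  refine isManifold_of_contDiffOn _ _ _ fun e e' he he' => ?_
  have h : ContDiffOn ℝ ∞ (e.symm ≫ₕ e') (e.symm ≫ₕ e').source := fun y hy =>
    (((contDiffAt_transition he he' hy).restrict_scalars ℝ).of_le le_top).contDiffWithinAt
  simpa using h

theorem jacobian_mul_jacobian (he : e ∈ atlas (Fin n → ℂ) X) (he' : e' ∈ atlas (Fin n → ℂ) X)
    (hy : y ∈ (e.symm ≫ₕ e').source) :
    jacobian (e'.symm ≫ₕ e) ((e.symm ≫ₕ e') y) * jacobian (e.symm ≫ₕ e') y = 1 := by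
  have hcomp := fderiv_comp y (differentiableAt_transition he' he (transition_mem_overlap hy))
    (differentiableAt_transition he he' hy)
  have hid : (e'.symm ≫ₕ e) ∘ (e.symm ≫ₕ e') =ᶠ[𝓝 y] id := by
    filter_upwards [overlap_mem_nhds hy] with z hz using transition_transition hz
  rw [hid.fderiv_eq, fderiv_id] at hcomp
  rw [jacobian, jacobian, ← LinearMap.toMatrix'_comp, ← ContinuousLinearMap.toLinearMap_comp,
    ← hcomp]
  exact LinearMap.toMatrix'_id

theorem isUnit_det_jacobian (he : e ∈ atlas (Fin n → ℂ) X) (he' : e' ∈ atlas (Fin n → ℂ) X)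
    (hy : y ∈ (e.symm ≫ₕ e').source) : IsUnit (jacobian (e.symm ≫ₕ e') y).det :=
  Matrix.isUnit_det_of_left_inverse (jacobian_mul_jacobian he he' hy)

theorem contDiffAt_comp_symm {F : Type*} [NormedAddCommGroup F] [NormedSpace ℝ F] {f : X → F}
    (hf : ContMDiff 𝓘(ℝ, Fin n → ℂ) 𝓘(ℝ, F) ∞ f) (he : e ∈ atlas (Fin n → ℂ) X)
    (hy : y ∈ e.target) : ContDiffAt ℝ ∞ (fun y => f (e.symm y)) y := by
  have := isManifold_real n X
  have h := contMDiffOn_symm_of_mem_maximalAtlas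
    (IsManifold.subset_maximalAtlas (I := 𝓘(ℝ, Fin n → ℂ)) (n := ∞) he)
  exact (hf.comp_contMDiffOn h).contDiffOn.contDiffAt (e.open_target.mem_nhds hy)

theorem del_transform {u : X → ℂ} (hu : SmoothComplex n u) (he : e ∈ atlas (Fin n → ℂ) X)
    (he' : e' ∈ atlas (Fin n → ℂ) X) (hy : y ∈ (e.symm ≫ₕ e').source) :
    del u e y = del u e' ((e.symm ≫ₕ e') y) ᵥ* jacobian (e.symm ≫ₕ e') y := by
  ext i
  rw [del, dz_congr (comp_symm_eventuallyEq u hy), dz_comp_holomorphic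
    ((contDiffAt_comp_symm hu he' (transition_mem_target hy)).differentiableAt (by simp))
    (differentiableAt_transition he he' hy)]
  rfl

theorem dbar_transform {u : X → ℂ} (hu : SmoothComplex n u) (he : e ∈ atlas (Fin n → ℂ) X)
    (he' : e' ∈ atlas (Fin n → ℂ) X) (hy : y ∈ (e.symm ≫ₕ e').source) :
    dbar u e y = dbar u e' ((e.symm ≫ₕ e') y) ᵥ*
      (jacobian (e.symm ≫ₕ e') y).map (starRingEnd ℂ) := by
  ext i
  rw [dbar, dzbar_congr (comp_symm_eventuallyEq u hy), dzbar_comp_holomorphic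
    ((contDiffAt_comp_symm hu he' (transition_mem_target hy)).differentiableAt (by simp))
    (differentiableAt_transition he he' hy)]
  rfl

theorem preservedBy_id_ddbar {f : X → ℝ} (hf : SmoothReal n f) :
    PreservedBy id (ddbar f : Form11 n X) := by
  refine preservedBy_id_iff.2 fun e he e' he' y hy => ?_
  change complexHessian (fun y => (f (e.symm y) : ℂ)) y = _
  rw [complexHessian_congr (comp_symm_eventuallyEq (fun x => (f x : ℂ)) hy),
    complexHessian_comp_holomorphic
      ((contDiffAt_comp_symm (smoothComplex_ofReal hf) he' (transition_mem_target hy)).of_le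
        (by norm_cast))
      ((contDiffAt_transition he he' hy).of_le le_top)]
  rfl

theorem isKahler_add_ddbar {h : Form11 n X} (hh : IsKahler h) {f : X → ℝ} (hf : SmoothReal n f)
    (hpos : IsPositive (h + ddbar f)) : IsKahler (h + ddbar f) where
  transform := preservedBy_add hh.transform (preservedBy_id_ddbar hf)
  smooth e he i j := by
    refine (hh.smooth e he i j).add fun y hy => ContDiffAt.contDiffWithinAt ?_
    exact contDiffAt_dz (contDiffAt_dzbar
      (contDiffAt_comp_symm (smoothComplex_ofReal hf) he hy) le_rfl j) le_rfl i
  positive := hpos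
  closed e he y hy i j k := by
    have hf' : ContDiffAt ℝ ∞ (dzbar (fun y => (f (e.symm y) : ℂ)) j) y :=
      contDiffAt_dzbar (contDiffAt_comp_symm (smoothComplex_ofReal hf) he hy) le_rfl j
    have dz_entry (i k : Fin n) : dz (fun y => (h + ddbar f : Form11 n X) e y i j) k y
        = dz (fun y => h e y i j) k y
          + dz (dz (dzbar (fun y => (f (e.symm y) : ℂ)) j) i) k y :=
      dz_add (((hh.smooth e he i j).contDiffAt (e.open_target.mem_nhds hy)).differentiableAt
        (by simp)) ((contDiffAt_dz (k := ∞) hf' le_rfl i).differentiableAt (by simp))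
    rw [dz_entry, dz_entry, hh.closed e he y hy, dz_dz_comm (hf'.of_le (by norm_cast))]

end Coordinates

/-! ### Vector fields of type `(1,0)` and gradients -/

section VectorField

/-- The components `Vⁱ` of a vector field `∑ Vⁱ ∂/∂zⁱ` of type `(1,0)` in the holomorphic charts.
Only the values for `e` in the atlas and `y` in the target of `e` are meaningful. -/
abbrev Field10 (n : ℕ) (X : Type*) [TopologicalSpace X] : Type _ :=
  OpenPartialHomeomorph X (Fin n → ℂ) → (Fin n → ℂ) → Fin n → ℂ

variable {n : ℕ} {X : Type*} [TopologicalSpace X] [ChartedSpace (Fin n → ℂ) X]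
  {e e' : OpenPartialHomeomorph X (Fin n → ℂ)} {y : Fin n → ℂ} {v : Field10 n X}

/-- `v` is a smooth vector field of type `(1,0)`: its components are smooth and transform with the
Jacobian matrix of the change of coordinates. -/
structure IsVectorField (v : Field10 n X) : Prop where
  smooth : ∀ e ∈ atlas (Fin n → ℂ) X, ∀ y ∈ e.target, ContDiffAt ℝ ∞ (v e) y
  transform : ∀ e ∈ atlas (Fin n → ℂ) X, ∀ e' ∈ atlas (Fin n → ℂ) X,
    ∀ y ∈ (e.symm ≫ₕ e').source,
      v e' ((e.symm ≫ₕ e') y) = jacobian (e.symm ≫ₕ e') y *ᵥ v e y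

/-- The derivative `∑ vⁱ ∂w/∂zⁱ` of the function `w` along `v`, computed in the preferred charts. -/
def vecDeriv (v : Field10 n X) (w : X → ℂ) (x : X) : ℂ :=
  v (chartAt (Fin n → ℂ) x) (chartAt (Fin n → ℂ) x x) ⬝ᵥ
    del w (chartAt (Fin n → ℂ) x) (chartAt (Fin n → ℂ) x x)

variable [IsManifold 𝓘(ℂ, Fin n → ℂ) ω X]

theorem vecDeriv_eq (hv : IsVectorField v) {w : X → ℂ} (hw : SmoothComplex n w)
    (he : e ∈ atlas (Fin n → ℂ) X) {x : X} (hx : x ∈ e.source) :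
    vecDeriv v w x = v e (e x) ⬝ᵥ del w e (e x) := by
  have hc := chart_mem_atlas (Fin n → ℂ) x
  have hy := mem_overlap_of_mem_source (mem_chart_source (Fin n → ℂ) x) hx
  have htransition :
      ((chartAt (Fin n → ℂ) x).symm ≫ₕ e) (chartAt (Fin n → ℂ) x x) = e x :=
    congrArg e ((chartAt (Fin n → ℂ) x).left_inv (mem_chart_source _ x))
  have hdel := del_transform hw hc he hy
  have hv' := hv.transform _ hc e he _ hy
  rw [htransition] at hdel hv'
  rw [vecDeriv, hdel, hv', dotProduct_comm, ← Matrix.dotProduct_mulVec, dotProduct_comm]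

theorem dbarMatrix_transform (hv : IsVectorField v) (he : e ∈ atlas (Fin n → ℂ) X)
    (he' : e' ∈ atlas (Fin n → ℂ) X) (hy : y ∈ (e.symm ≫ₕ e').source) :
    dbarMatrix (v e') ((e.symm ≫ₕ e') y) * (jacobian (e.symm ≫ₕ e') y).map (starRingEnd ℂ)
      = jacobian (e.symm ≫ₕ e') y * dbarMatrix (v e) y := by
  have hτ := contDiffAt_transition he he' hy
  have hd {c : OpenPartialHomeomorph X (Fin n → ℂ)} {z : Fin n → ℂ}
      (hc : c ∈ atlas (Fin n → ℂ) X) (hz : z ∈ c.target) (i : Fin n) :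
      DifferentiableAt ℝ (fun y => v c y i) z :=
    (contDiffAt_pi.1 (hv.smooth c hc z hz) i).differentiableAt (by simp)
  ext k j
  have hJ (i : Fin n) := differentiableAt_jacobian (hτ.of_le le_top) k i
  have htransform : (fun z => v e' ((e.symm ≫ₕ e') z) k)
      =ᶠ[𝓝 y] fun z => ∑ i, jacobian (e.symm ≫ₕ e') z k i * v e z i := by
    filter_upwards [overlap_mem_nhds hy] with z hz
    exact congrFun (hv.transform e he e' he' z hz) k
  refine (dzbar_comp_holomorphic (hd he' (transition_mem_target hy) k)
    (differentiableAt_transition he he' hy)).symm.trans ?_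
  rw [dzbar_congr htransform, dzbar_sum fun i _ => ((hJ i).restrictScalars ℝ).fun_mul
    (hd he (mem_target_of_mem_overlap hy) i)]
  refine Finset.sum_congr rfl fun i _ => ?_
  rw [dzbar_mul ((hJ i).restrictScalars ℝ) (hd he (mem_target_of_mem_overlap hy) i),
    dzbar_eq_zero_of_differentiableAt (hJ i), zero_mul, zero_add]
  rfl

theorem isVectorField_conjDeriv (hv : IsVectorField v) :
    IsVectorField fun e => conjDeriv (v e) where
  smooth e he y hy := contDiffAt_conjDeriv (hv.smooth e he y hy) le_rfl
  transform e he e' he' y hy := by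
    have hstar : star (v e' ((e.symm ≫ₕ e') y))
        = (jacobian (e.symm ≫ₕ e') y).map (starRingEnd ℂ) *ᵥ star (v e y) := by
      rw [hv.transform e he e' he' y hy, Matrix.star_mulVec, ← Matrix.mulVec_transpose]
      rfl
    rw [conjDeriv, conjDeriv, hstar, Matrix.mulVec_mulVec, Matrix.mulVec_mulVec,
      dbarMatrix_transform hv he he' hy]

end VectorField

section Gradient

theorem contDiffAt_det {E : Type*} [NormedAddCommGroup E] [NormedSpace ℝ E] {m : ℕ}
    {k : WithTop ℕ∞} {A : E → Matrix (Fin m) (Fin m) ℂ} {y : E}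
    (hA : ∀ i j, ContDiffAt ℝ k (fun y => A y i j) y) :
    ContDiffAt ℝ k (fun y => (A y).det) y := by
  simp only [Matrix.det_apply']
  exact ContDiffAt.sum fun σ _ => contDiffAt_const.mul (contDiffAt_prod fun i _ => hA _ _)

theorem contDiffAt_inv {E : Type*} [NormedAddCommGroup E] [NormedSpace ℝ E] {m : ℕ}
    {k : WithTop ℕ∞} {A : E → Matrix (Fin m) (Fin m) ℂ} {y : E}
    (hA : ∀ i j, ContDiffAt ℝ k (fun y => A y i j) y) (hdet : IsUnit (A y).det) (i j : Fin m) :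
    ContDiffAt ℝ k (fun y => (A y)⁻¹ i j) y := by
  simp only [Matrix.inv_def, Matrix.smul_apply, Matrix.adjugate_apply, Ring.inverse_eq_inv',
    smul_eq_mul]
  refine ((contDiffAt_det hA).inv hdet.ne_zero).mul (contDiffAt_det fun k l => ?_)
  by_cases hk : k = j
  · subst hk
    simpa using contDiffAt_const
  · simpa [Matrix.updateRow_ne hk] using hA k l

variable {n : ℕ} {X : Type*} [TopologicalSpace X]

/-- The gradient `∑ h^{i j̄} ∂_{j̄} u ∂/∂zⁱ` of `u` with respect to the Hermitian metric `h`. -/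
def grad (h : Form11 n X) (u : X → ℂ) : Field10 n X :=
  fun e y => dbar u e y ᵥ* (h e y)⁻¹

variable {h : Form11 n X} {u w : X → ℂ} {e : OpenPartialHomeomorph X (Fin n → ℂ)}
  {y : Fin n → ℂ}

theorem del_conj : del (fun x => starRingEnd ℂ (u x)) e y = star (dbar u e y) :=
  funext fun _ => dz_conj

variable [ChartedSpace (Fin n → ℂ) X]

theorem isUnit_det_of_isPositive (hh : IsPositive h) (he : e ∈ atlas (Fin n → ℂ) X)
    (hy : y ∈ e.target) : IsUnit (h e y).det :=
  (Matrix.isUnit_iff_isUnit_det _).1 (hh e he y hy).isUnit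

theorem grad_vecMul (hh : IsPositive h) (he : e ∈ atlas (Fin n → ℂ) X) (hy : y ∈ e.target) :
    grad h u e y ᵥ* h e y = dbar u e y := by
  rw [grad, Matrix.vecMul_vecMul, Matrix.nonsing_inv_mul _ (isUnit_det_of_isPositive hh he hy),
    Matrix.vecMul_one]

theorem inner01_mul_dbar_dbar (G : X → ℝ) (x : X) :
    inner01 h (fun e y j => (G (e.symm y) : ℂ) * dbar u e y j) (dbar w) x
      = G x * vecDeriv (grad h u) (fun x => starRingEnd ℂ (w x)) x := by
  simp only [inner01, vecDeriv, del_conj, grad, Matrix.vecMul, dotProduct, Finset.mul_sum,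
    Finset.sum_mul, (chartAt (Fin n → ℂ) x).left_inv (mem_chart_source _ x), Pi.star_apply]
  refine Finset.sum_congr rfl fun i _ => Finset.sum_congr rfl fun j _ => ?_
  rw [starRingEnd_apply]
  ring

theorem vecDeriv_grad_conj (hh : IsPositive h) (x : X) :
    vecDeriv (grad h u) (fun x => starRingEnd ℂ (u x)) x
      = grad h u (chartAt (Fin n → ℂ) x) (chartAt (Fin n → ℂ) x x) ⬝ᵥ
        (h (chartAt (Fin n → ℂ) x) (chartAt (Fin n → ℂ) x x) *ᵥ
          star (grad h u (chartAt (Fin n → ℂ) x) (chartAt (Fin n → ℂ) x x))) := by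
  have hc := chart_mem_atlas (Fin n → ℂ) x
  have hy := mem_chart_target (Fin n → ℂ) x
  rw [vecDeriv, del_conj, ← grad_vecMul hh hc hy, Matrix.star_vecMul,
    (hh _ hc _ hy).isHermitian.eq]

theorem vecDeriv_grad_conj_nonneg (hh : IsPositive h) (x : X) :
    0 ≤ vecDeriv (grad h u) (fun x => starRingEnd ℂ (u x)) x := by
  rw [vecDeriv_grad_conj hh]
  simpa only [star_star] using (hh _ (chart_mem_atlas _ x) _
    (mem_chart_target _ x)).posSemidef.dotProduct_mulVec_nonneg (star (grad h u _ _))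

theorem dzbar_symm_of_isKahler (hh : IsKahler h) (he : e ∈ atlas (Fin n → ℂ) X)
    (hy : y ∈ e.target) (i j k : Fin n) :
    dzbar (fun y => h e y i j) k y = dzbar (fun y => h e y i k) j y := by
  have dzbar_eq (j k : Fin n) :
      dzbar (fun y => h e y i j) k y = starRingEnd ℂ (dz (fun y => h e y j i) k y) := by
    rw [← dzbar_conj]
    refine dzbar_congr ?_
    filter_upwards [e.open_target.mem_nhds hy] with z hz
    exact ((hh.positive e he z hz).isHermitian.apply i j).symm
  rw [dzbar_eq, dzbar_eq, hh.closed e he y hy]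

variable [IsManifold 𝓘(ℂ, Fin n → ℂ) ω X]

theorem contDiffAt_grad (hh : IsKahler h) (hu : SmoothComplex n u)
    (he : e ∈ atlas (Fin n → ℂ) X) (hy : y ∈ e.target) : ContDiffAt ℝ ∞ (grad h u e) y := by
  refine contDiffAt_pi.2 fun i => ?_
  simp only [grad, Matrix.vecMul, dotProduct]
  exact ContDiffAt.sum fun j _ => ContDiffAt.mul
    (contDiffAt_dzbar (contDiffAt_comp_symm hu he hy) le_rfl j) (contDiffAt_inv (fun i j =>
      (hh.smooth e he i j).contDiffAt (e.open_target.mem_nhds hy))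
      (isUnit_det_of_isPositive hh.positive he hy) j i)

theorem isVectorField_grad (hh : IsKahler h) (hu : SmoothComplex n u) :
    IsVectorField (grad h u) where
  smooth e he y hy := contDiffAt_grad hh hu he hy
  transform e he e' he' y hy := by
    set J := jacobian (e.symm ≫ₕ e') y
    have hJu : IsUnit (J.map (starRingEnd ℂ)).det := by
      have := (isUnit_det_jacobian he he' hy).map (starRingEnd ℂ)
      rwa [RingHom.map_det] at this
    have hvec : (J *ᵥ grad h u e y) ᵥ* h e' ((e.symm ≫ₕ e') y) ᵥ* J.map (starRingEnd ℂ)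
        = dbar u e' ((e.symm ≫ₕ e') y) ᵥ* J.map (starRingEnd ℂ) := by
      rw [← dbar_transform hu he he' hy,
        ← grad_vecMul hh.positive he (mem_target_of_mem_overlap hy),
        preservedBy_id_iff.1 hh.transform e he e' he' y hy, ← Matrix.vecMul_transpose,
        Matrix.vecMul_vecMul, Matrix.vecMul_vecMul, Matrix.mul_assoc]
    have hdbar := Matrix.vecMul_injective_of_isUnit
      ((Matrix.isUnit_iff_isUnit_det _).2 hJu) hvec
    rw [grad, ← hdbar, Matrix.vecMul_vecMul, Matrix.mul_nonsing_inv _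
      (isUnit_det_of_isPositive hh.positive he' (transition_mem_target hy)), Matrix.vecMul_one]

theorem transpose_mul_dbarMatrix_grad_isSymm (hh : IsKahler h) (hu : SmoothComplex n u)
    (he : e ∈ atlas (Fin n → ℂ) X) (hy : y ∈ e.target) :
    ((h e y)ᵀ * dbarMatrix (grad h u e) y).IsSymm := by
  have hdh (i j : Fin n) : DifferentiableAt ℝ (fun y => h e y i j) y :=
    ((hh.smooth e he i j).contDiffAt (e.open_target.mem_nhds hy)).differentiableAt (by simp)
  have hdV (i : Fin n) : DifferentiableAt ℝ (fun y => grad h u e y i) y :=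
    (contDiffAt_pi.1 (contDiffAt_grad hh hu he hy) i).differentiableAt (by simp)
  have entry (j k : Fin n) : ((h e y)ᵀ * dbarMatrix (grad h u e) y) j k
      = dzbar (dzbar (fun y => u (e.symm y)) j) k y
        - ∑ i, dzbar (fun y => h e y i j) k y * grad h u e y i := by
    have hgrad : dzbar (fun y => u (e.symm y)) j =ᶠ[𝓝 y]
        fun y => ∑ i, h e y i j * grad h u e y i := by
      filter_upwards [e.open_target.mem_nhds hy] with z hz
      refine (congrFun (grad_vecMul (u := u) hh.positive he hz) j).symm.trans ?_
      simp only [Matrix.vecMul, dotProduct, mul_comm]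
    rw [dzbar_congr hgrad, dzbar_sum fun i _ => (hdh i j).fun_mul (hdV i),
      ← Finset.sum_sub_distrib, Matrix.mul_apply]
    refine Finset.sum_congr rfl fun i _ => ?_
    rw [dzbar_mul (hdh i j) (hdV i), add_sub_cancel_left]
    rfl
  ext j k
  rw [Matrix.transpose_apply, entry, entry, dzbar_dzbar_comm
    ((contDiffAt_comp_symm hu he hy).of_le (by norm_cast))]
  simp only [dzbar_symm_of_isKahler hh he hy _ k j]

end Gradient

/-! ### The volume measure of a Kähler form -/

section Volume

open MeasureTheory

section Density

variable {n : ℕ}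

theorem det_restrictScalars_fderiv {τ : (Fin n → ℂ) → (Fin n → ℂ)} {y : Fin n → ℂ} :
    ((fderiv ℂ τ y).restrictScalars ℝ).det = Complex.normSq (jacobian τ y).det := by
  rw [jacobian, LinearMap.det_toMatrix', ← Algebra.norm_complex_apply,
    ← LinearMap.det_restrictScalars]
  rfl

theorem target_inter_preimage_eq_image {X : Type*} [TopologicalSpace X]
    {e e' : OpenPartialHomeomorph X (Fin n → ℂ)} {A : Set X} (hAe : A ⊆ e.source)
    (hAe' : A ⊆ e'.source) :
    e'.target ∩ e'.symm ⁻¹' A = (e.symm ≫ₕ e') '' (e.target ∩ e.symm ⁻¹' A) := by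
  rw [← e.image_eq_target_inter_inv_preimage hAe, ← e'.image_eq_target_inter_inv_preimage hAe',
    Set.image_image]
  refine Set.image_congr fun x hx => ?_
  rw [OpenPartialHomeomorph.coe_trans, Function.comp_apply, e.left_inv (hAe hx)]

variable {X : Type*} [TopologicalSpace X] [ChartedSpace (Fin n → ℂ) X] {h : Form11 n X}
  {e e' : OpenPartialHomeomorph X (Fin n → ℂ)} {y : Fin n → ℂ}

theorem volDensity_pos (hh : IsPositive h) (he : e ∈ atlas (Fin n → ℂ) X) (hy : y ∈ e.target) :
    0 < volDensity h e y := by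
  have := (Complex.pos_iff.1 (hh e he y hy).det_pos).1
  unfold volDensity
  positivity

theorem contDiffAt_volDensity (hh : IsKahler h) (he : e ∈ atlas (Fin n → ℂ) X)
    (hy : y ∈ e.target) : ContDiffAt ℝ ∞ (volDensity h e) y :=
  contDiffAt_const.mul (Complex.reCLM.contDiff.contDiffAt.comp y (contDiffAt_det fun i j =>
    (hh.smooth e he i j).contDiffAt (e.open_target.mem_nhds hy)))

theorem continuousOn_volDensity (hh : IsKahler h) (he : e ∈ atlas (Fin n → ℂ) X) :
    ContinuousOn (volDensity h e) e.target :=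
  fun _ hy => (contDiffAt_volDensity hh he hy).continuousAt.continuousWithinAt

theorem aemeasurable_volDensity (hh : IsKahler h) (he : e ∈ atlas (Fin n → ℂ) X) :
    AEMeasurable (fun y => ENNReal.ofReal (volDensity h e y)) (volume.restrict e.target) :=
  ((continuousOn_volDensity hh he).aemeasurable e.open_target.measurableSet).ennreal_ofReal

theorem volDensity_transform (hh : PreservedBy id h) (he : e ∈ atlas (Fin n → ℂ) X)
    (he' : e' ∈ atlas (Fin n → ℂ) X) (hy : y ∈ (e.symm ≫ₕ e').source) :
    volDensity h e y = Complex.normSq (jacobian (e.symm ≫ₕ e') y).det *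
      volDensity h e' ((e.symm ≫ₕ e') y) := by
  have hconj : ((jacobian (e.symm ≫ₕ e') y).map (starRingEnd ℂ)).det
      = starRingEnd ℂ (jacobian (e.symm ≫ₕ e') y).det := by
    rw [RingHom.map_det]
    rfl
  rw [volDensity, volDensity, preservedBy_id_iff.1 hh e he e' he' y hy, Matrix.det_mul,
    Matrix.det_mul, Matrix.det_transpose, hconj, mul_right_comm (Matrix.det _),
    Complex.mul_conj, Complex.re_ofReal_mul]
  ring

end Density

variable {n : ℕ} {X : Type*} [TopologicalSpace X] [MeasurableSpace X]

/-- The measure on the domain of the chart `e` defined by the volume form of `h`. -/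
def chartMeasure (h : Form11 n X) (e : OpenPartialHomeomorph X (Fin n → ℂ)) : Measure X :=
  Measure.map e.symm ((volume.restrict e.target).withDensity
    fun y => ENNReal.ofReal (volDensity h e y))

theorem chartMeasure_le_volMeasure [ChartedSpace (Fin n → ℂ) X] (h : Form11 n X)
    {e : OpenPartialHomeomorph X (Fin n → ℂ)} (he : e ∈ atlas (Fin n → ℂ) X) :
    chartMeasure h e ≤ volMeasure h :=
  le_iSup₂ (f := fun e _ => chartMeasure h e) e he

variable [BorelSpace X] {h : Form11 n X} {e e' : OpenPartialHomeomorph X (Fin n → ℂ)}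

theorem aemeasurable_symm :
    AEMeasurable e.symm ((volume.restrict e.target).withDensity
      fun y => ENNReal.ofReal (volDensity h e y)) :=
  (e.continuousOn_symm.aemeasurable e.open_target.measurableSet).mono_ac
    (withDensity_absolutelyContinuous _ _)

theorem chartMeasure_apply {A : Set X} (hA : MeasurableSet A) :
    chartMeasure h e A
      = ∫⁻ y in e.target ∩ e.symm ⁻¹' A, ENNReal.ofReal (volDensity h e y) := by
  rw [chartMeasure, Measure.map_apply_of_aemeasurable aemeasurable_symm hA, withDensity_apply',
    Measure.restrict_restrict' e.open_target.measurableSet, Set.inter_comm]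

theorem chartMeasure_compl_source : chartMeasure h e e.sourceᶜ = 0 := by
  have hempty : e.target ∩ e.symm ⁻¹' e.sourceᶜ = ∅ :=
    Set.eq_empty_of_forall_notMem fun y hy => hy.2 (e.map_target hy.1)
  rw [chartMeasure_apply e.open_source.measurableSet.compl, hempty, Measure.restrict_empty,
    lintegral_zero_measure]

theorem chartMeasure_inter_source (A : Set X) :
    chartMeasure h e (A ∩ e.source) = chartMeasure h e A :=
  measure_inter_conull chartMeasure_compl_source

theorem measurableSet_target_inter_preimage {A : Set X} (hA : MeasurableSet A) :
    MeasurableSet (e.target ∩ e.symm ⁻¹' A) := by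
  have hsymm : Measurable (e.target.domRestrict e.symm) :=
    (continuousOn_iff_continuous_domRestrict.1 e.continuousOn_symm).measurable
  have himage := (MeasurableEmbedding.subtype_coe
    e.open_target.measurableSet).measurableSet_image' (hsymm hA)
  rwa [Set.domRestrict_eq, Set.preimage_comp, Subtype.image_preimage_coe] at himage

variable [ChartedSpace (Fin n → ℂ) X]

theorem isOpenPosMeasure_volMeasure (hh : IsKahler h) : (volMeasure h).IsOpenPosMeasure := by
  refine ⟨fun O hO ⟨x, hx⟩ hO0 => ?_⟩
  set e := chartAt (Fin n → ℂ) x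
  have he : e ∈ atlas (Fin n → ℂ) X := chart_mem_atlas _ x
  have hO0' : chartMeasure h e O = 0 :=
    le_antisymm ((chartMeasure_le_volMeasure h he O).trans hO0.le) bot_le
  have hvolume : volume.restrict e.target (e.symm ⁻¹' O) = 0 := by
    rw [chartMeasure, Measure.map_apply_of_aemeasurable aemeasurable_symm hO.measurableSet] at hO0'
    refine withDensity_absolutelyContinuous' (aemeasurable_volDensity hh he) ?_ hO0'
    filter_upwards [ae_restrict_mem e.open_target.measurableSet] with y hy
    exact (ENNReal.ofReal_pos.2 (volDensity_pos hh.positive he hy)).ne'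
  rw [Measure.restrict_apply' e.open_target.measurableSet, Set.inter_comm] at hvolume
  refine ((e.isOpen_inter_preimage_symm hO).measure_pos volume ⟨e x, mem_chart_target _ x, ?_⟩).ne'
    hvolume
  rwa [Set.mem_preimage, e.left_inv (mem_chart_source _ x)]

theorem chartMeasure_eq_of_subset [IsManifold 𝓘(ℂ, Fin n → ℂ) ω X] (hh : PreservedBy id h)
    (he : e ∈ atlas (Fin n → ℂ) X) (he' : e' ∈ atlas (Fin n → ℂ) X) {A : Set X}
    (hA : MeasurableSet A) (hAe : A ⊆ e.source) (hAe' : A ⊆ e'.source) :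
    chartMeasure h e A = chartMeasure h e' A := by
  have hsub : e.target ∩ e.symm ⁻¹' A ⊆ (e.symm ≫ₕ e').source := fun y hy =>
    ⟨hy.1, hAe' hy.2⟩
  rw [chartMeasure_apply hA, chartMeasure_apply hA, target_inter_preimage_eq_image hAe hAe',
    lintegral_image_eq_lintegral_abs_det_fderiv_mul volume
      (measurableSet_target_inter_preimage hA)
      (f' := fun y => (fderiv ℂ (e.symm ≫ₕ e') y).restrictScalars ℝ)
      (fun y hy => ((differentiableAt_transition he he' (hsub hy)).hasFDerivAt.restrictScalars
        ℝ).hasFDerivWithinAt)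
      ((e.symm ≫ₕ e').injOn.mono hsub)]
  refine setLIntegral_congr_fun (measurableSet_target_inter_preimage hA) fun y hy => ?_
  rw [det_restrictScalars_fderiv, abs_of_nonneg (Complex.normSq_nonneg _),
    volDensity_transform hh he he' (hsub hy), ENNReal.ofReal_mul (Complex.normSq_nonneg _)]

theorem volMeasure_restrict_source [IsManifold 𝓘(ℂ, Fin n → ℂ) ω X] (hh : PreservedBy id h)
    (he : e ∈ atlas (Fin n → ℂ) X) : (volMeasure h).restrict e.source = chartMeasure h e := by
  have hs := e.open_source.measurableSet
  have hle : volMeasure h ≤ chartMeasure h e + (volMeasure h).restrict e.sourceᶜ := by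
    refine iSup₂_le fun e' he' => Measure.le_iff.2 fun B hB => ?_
    change chartMeasure h e' B ≤ _
    have hB' := (hB.inter hs).inter e'.open_source.measurableSet
    rw [← measure_inter_add_sdiff B hs, Measure.add_apply, Measure.restrict_apply hB,
      ← Set.sdiff_eq, ← chartMeasure_inter_source (B ∩ e.source),
      chartMeasure_eq_of_subset hh he' he hB' Set.inter_subset_right
        (Set.inter_subset_left.trans Set.inter_subset_right)]
    exact add_le_add (measure_mono (Set.inter_subset_left.trans Set.inter_subset_left))
      (chartMeasure_le_volMeasure h he' _)
  ext A hA
  rw [Measure.restrict_apply hA, ← chartMeasure_inter_source A]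
  refine le_antisymm ((hle _).trans_eq ?_) (chartMeasure_le_volMeasure h he _)
  rw [Measure.add_apply, Measure.restrict_apply (hA.inter hs), Set.inter_assoc,
    Set.inter_compl_self, Set.inter_empty, measure_empty, add_zero]

theorem volMeasure_apply_of_subset [IsManifold 𝓘(ℂ, Fin n → ℂ) ω X] (hh : PreservedBy id h)
    (he : e ∈ atlas (Fin n → ℂ) X) {A : Set X} (hAe : A ⊆ e.source) :
    volMeasure h A = chartMeasure h e A := by
  rw [← volMeasure_restrict_source hh he, Measure.restrict_eq_self _ hAe]

variable [IsManifold 𝓘(ℂ, Fin n → ℂ) ω X]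

theorem integral_volMeasure_eq (hh : IsKahler h) (he : e ∈ atlas (Fin n → ℂ) X) {F : X → ℂ}
    (hF : ContinuousOn F e.source) (hF0 : ∀ x ∉ e.source, F x = 0) :
    ∫ x, F x ∂(volMeasure h) = ∫ y in e.target, (volDensity h e y : ℂ) * F (e.symm y) := by
  have hm : AEStronglyMeasurable F (chartMeasure h e) := by
    rw [← volMeasure_restrict_source hh.transform he]
    exact hF.aestronglyMeasurable e.open_source.measurableSet
  rw [← setIntegral_eq_integral_of_forall_compl_eq_zero hF0,
    volMeasure_restrict_source hh.transform he, chartMeasure, integral_map aemeasurable_symm hm,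
    integral_withDensity_eq_integral_toReal_smul₀ (aemeasurable_volDensity hh he) (by simp)]
  refine setIntegral_congr_fun e.open_target.measurableSet fun y hy => ?_
  rw [ENNReal.toReal_ofReal (volDensity_pos hh.positive he hy).le, Complex.real_smul]

theorem isFiniteMeasure_volMeasure [CompactSpace X] (hh : IsKahler h) :
    IsFiniteMeasure (volMeasure h) := by
  have : IsLocallyFiniteMeasure (volMeasure h) := by
    refine ⟨fun x => ?_⟩
    set e := chartAt (Fin n → ℂ) x
    have he : e ∈ atlas (Fin n → ℂ) X := chart_mem_atlas _ x
    have hxe : x ∈ e.source := mem_chart_source _ x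
    obtain ⟨K, hKc, hxK, hKe⟩ := exists_compact_subset e.open_target (e.map_source hxe)
    have hO : IsOpen (e.source ∩ e ⁻¹' interior K) := e.isOpen_inter_preimage isOpen_interior
    refine ⟨_, hO.mem_nhds ⟨hxe, hxK⟩, ?_⟩
    rw [volMeasure_apply_of_subset hh.transform he Set.inter_subset_left,
      chartMeasure_apply hO.measurableSet]
    refine lt_of_le_of_lt (lintegral_mono_set (t := K) ?_)
      (((continuousOn_volDensity hh he).mono hKe).integrableOn_compact hKc).lintegral_lt_top
    rintro y ⟨hy, -, hyK⟩
    exact interior_subset (e.right_inv hy ▸ hyK)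
  exact CompactSpace.isFiniteMeasure

end Volume

/-! ### The weighted divergence -/

section ChartExtension

variable {n : ℕ} {X : Type*} [TopologicalSpace X] {χ : X → ℂ}
  {e : OpenPartialHomeomorph X (Fin n → ℂ)} {y : Fin n → ℂ}

/-- The expression of the function `χ` in the chart `e`, extended by zero to `ℂⁿ`. -/
def chartExtension (χ : X → ℂ) (e : OpenPartialHomeomorph X (Fin n → ℂ)) : (Fin n → ℂ) → ℂ :=
  e.target.indicator fun y => χ (e.symm y)

theorem chartExtension_eventuallyEq (hy : y ∈ e.target) :
    chartExtension χ e =ᶠ[𝓝 y] fun y => χ (e.symm y) := by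
  filter_upwards [e.open_target.mem_nhds hy] with z hz using Set.indicator_of_mem hz _

variable [CompactSpace X]

theorem isCompact_image_tsupport (hχe : tsupport χ ⊆ e.source) : IsCompact (e '' tsupport χ) :=
  (isClosed_tsupport χ).isCompact.image_of_continuousOn (e.continuousOn.mono hχe)

theorem tsupport_chartExtension_subset (hχe : tsupport χ ⊆ e.source) :
    tsupport (chartExtension χ e) ⊆ e '' tsupport χ := by
  refine closure_minimal (fun y hy => ?_) (isCompact_image_tsupport hχe).isClosed
  have hy' : y ∈ e.target := Set.mem_of_indicator_ne_zero hy
  refine ⟨e.symm y, subset_tsupport χ ?_, e.right_inv hy'⟩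
  rwa [Function.mem_support, chartExtension, Set.indicator_of_mem hy'] at hy

theorem tsupport_chartExtension_subset_target (hχe : tsupport χ ⊆ e.source) :
    tsupport (chartExtension χ e) ⊆ e.target :=
  (tsupport_chartExtension_subset hχe).trans
    ((Set.image_mono hχe).trans e.image_source_eq_target.subset)

theorem hasCompactSupport_chartExtension (hχe : tsupport χ ⊆ e.source) :
    HasCompactSupport (chartExtension χ e) :=
  (isCompact_image_tsupport hχe).of_isClosed_subset (isClosed_tsupport _)
    (tsupport_chartExtension_subset hχe)

theorem contDiff_chartExtension [ChartedSpace (Fin n → ℂ) X] [IsManifold 𝓘(ℂ, Fin n → ℂ) ω X]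
    (hχ : SmoothComplex n χ) (he : e ∈ atlas (Fin n → ℂ) X) (hχe : tsupport χ ⊆ e.source) :
    ContDiff ℝ ∞ (chartExtension χ e) :=
  contMDiff_iff_contDiff.1 <| contMDiff_of_tsupport fun _ hy =>
    have hy' := tsupport_chartExtension_subset_target hχe hy
    ((contDiffAt_comp_symm hχ he hy').congr_of_eventuallyEq
      (chartExtension_eventuallyEq hy')).contMDiffAt

end ChartExtension

section Partition

variable (n : ℕ) (X : Type*) [TopologicalSpace X] [ChartedSpace (Fin n → ℂ) X]
  [IsManifold 𝓘(ℂ, Fin n → ℂ) ω X] [CompactSpace X] [T2Space X]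

theorem exists_finite_partition : ∃ (s : Finset X) (χ : X → X → ℝ),
    (∀ a, SmoothReal n (χ a)) ∧ (∀ x, ∑ a ∈ s, χ a x = 1) ∧
      ∀ a, tsupport (χ a) ⊆ (chartAt (Fin n → ℂ) a).source := by
  have := isManifold_real n X
  obtain ⟨f, hf⟩ :=
    SmoothPartitionOfUnity.exists_isSubordinate_chartAt_source 𝓘(ℝ, Fin n → ℂ) X
  have hfin := f.locallyFinite.finite_nonempty_of_compact
  refine ⟨hfin.toFinset, fun a => f a, fun a => (f a).contMDiff, fun x => ?_, hf⟩
  rw [← f.sum_eq_one (Set.mem_univ x), finsum_eq_sum_of_support_subset]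
  exact fun a ha => hfin.mem_toFinset.2 ⟨x, ha⟩

end Partition

section Divergence

open MeasureTheory

variable {n : ℕ} {X : Type*} [TopologicalSpace X]

theorem continuousOn_of_contDiffAt {e : OpenPartialHomeomorph X (Fin n → ℂ)}
    {F : (Fin n → ℂ) → ℂ} (hF : ∀ y ∈ e.target, ContDiffAt ℝ ∞ F y) :
    ContinuousOn (fun x => F (e x)) e.source :=
  ContinuousOn.comp (fun y hy => (hF y hy).continuousAt.continuousWithinAt) e.continuousOn
    e.mapsTo

/-- The logarithm of the density of the measure `G hⁿ` with respect to Lebesgue measure in the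
chart `e`, as a complex-valued function. -/
def logDensity (h : Form11 n X) (G : X → ℝ) (e : OpenPartialHomeomorph X (Fin n → ℂ))
    (y : Fin n → ℂ) : ℂ :=
  (Real.log (G (e.symm y) * volDensity h e y) : ℂ)

variable [ChartedSpace (Fin n → ℂ) X]

/-- The divergence of the vector field `v` of type `(1,0)` with respect to the measure `G hⁿ`,
computed in the preferred charts. -/
def divergence (h : Form11 n X) (G : X → ℝ) (v : Field10 n X) (x : X) : ℂ :=
  weightedDiv (logDensity h G (chartAt (Fin n → ℂ) x)) (v (chartAt (Fin n → ℂ) x))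
    (chartAt (Fin n → ℂ) x x)

variable {h : Form11 n X} {G : X → ℝ} {v : Field10 n X} {χ u w f : X → ℂ}
  {e : OpenPartialHomeomorph X (Fin n → ℂ)} {y : Fin n → ℂ}

theorem exp_logDensity (hh : IsPositive h) (hG0 : ∀ x, 0 < G x)
    (he : e ∈ atlas (Fin n → ℂ) X) (hy : y ∈ e.target) :
    Complex.exp (logDensity h G e y) = volDensity h e y * G (e.symm y) := by
  rw [logDensity, ← Complex.ofReal_exp,
    Real.exp_log (mul_pos (hG0 _) (volDensity_pos hh he hy)), Complex.ofReal_mul, mul_comm]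

theorem vecDeriv_eq_zero_of_notMem_tsupport {x : X} (hx : x ∉ tsupport w) :
    vecDeriv v w x = 0 := by
  have hc := (chartAt (Fin n → ℂ) x).continuousAt_symm (mem_chart_target (Fin n → ℂ) x)
  have hw : (fun y => w ((chartAt (Fin n → ℂ) x).symm y)) =ᶠ[𝓝 (chartAt (Fin n → ℂ) x x)] 0 := by
    refine hc.eventually (p := fun x => w x = 0) ?_
    rw [(chartAt (Fin n → ℂ) x).left_inv (mem_chart_source _ x)]
    exact notMem_tsupport_iff_eventuallyEq.1 hx
  have hdel : del w (chartAt (Fin n → ℂ) x) (chartAt (Fin n → ℂ) x x) = 0 :=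
    funext fun i => (dz_congr hw).trans (by simp [dz])
  rw [vecDeriv, hdel, dotProduct_zero]

theorem vecDeriv_const (c : ℂ) (x : X) : vecDeriv v (fun _ => c) x = 0 := by
  have hdel : del (fun _ => c) (chartAt (Fin n → ℂ) x) (chartAt (Fin n → ℂ) x x) = 0 :=
    funext fun i => by simp [del, dz]
  rw [vecDeriv, hdel, dotProduct_zero]

variable [IsManifold 𝓘(ℂ, Fin n → ℂ) ω X]

theorem contDiffAt_logDensity (hh : IsKahler h) (hG : SmoothReal n G) (hG0 : ∀ x, 0 < G x)
    (he : e ∈ atlas (Fin n → ℂ) X) (hy : y ∈ e.target) :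
    ContDiffAt ℝ ∞ (logDensity h G e) y :=
  contDiffAt_ofReal (((contDiffAt_comp_symm hG he hy).mul (contDiffAt_volDensity hh he hy)).log
    (mul_pos (hG0 _) (volDensity_pos hh.positive he hy)).ne')

theorem contDiffAt_weightedDiv_logDensity (hh : IsKahler h) (hG : SmoothReal n G)
    (hG0 : ∀ x, 0 < G x) (hv : IsVectorField v) (he : e ∈ atlas (Fin n → ℂ) X)
    (hy : y ∈ e.target) : ContDiffAt ℝ ∞ (weightedDiv (logDensity h G e) (v e)) y :=
  contDiffAt_weightedDiv (contDiffAt_logDensity hh hG hG0 he hy) (hv.smooth e he y hy) le_rfl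

theorem continuous_vecDeriv (hv : IsVectorField v) (hw : SmoothComplex n w) :
    Continuous (vecDeriv v w) := by
  refine continuous_iff_continuousAt.2 fun x => ?_
  set e := chartAt (Fin n → ℂ) x
  have he : e ∈ atlas (Fin n → ℂ) X := chart_mem_atlas _ x
  have hcoord : ContinuousOn (fun x => v e (e x) ⬝ᵥ del w e (e x)) e.source :=
    continuousOn_of_contDiffAt (F := fun y => v e y ⬝ᵥ del w e y) fun y hy =>
      ContDiffAt.sum fun i _ => (contDiffAt_pi.1 (hv.smooth e he y hy) i).mul
        (contDiffAt_dz (contDiffAt_comp_symm hw he hy) le_rfl i)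
  exact (hcoord.congr fun z hz => vecDeriv_eq hv hw he hz).continuousAt
    (chart_source_mem_nhds _ x)

theorem vecDeriv_sum {ι : Type*} {s : Finset ι} {w : ι → X → ℂ}
    (hw : ∀ a ∈ s, SmoothComplex n (w a)) (x : X) :
    vecDeriv v (fun x => ∑ a ∈ s, w a x) x = ∑ a ∈ s, vecDeriv v (w a) x := by
  have hdel : del (fun x => ∑ a ∈ s, w a x) (chartAt (Fin n → ℂ) x) (chartAt (Fin n → ℂ) x x)
      = ∑ a ∈ s, del (w a) (chartAt (Fin n → ℂ) x) (chartAt (Fin n → ℂ) x x) := by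
    ext i
    rw [Finset.sum_apply]
    exact dz_sum fun a ha => (contDiffAt_comp_symm (hw a ha) (chart_mem_atlas _ x)
      (mem_chart_target _ x)).differentiableAt (by simp)
  simp only [vecDeriv, hdel, dotProduct_sum]

variable [MeasurableSpace X] [BorelSpace X]

theorem integral_mul_eq_integral_exp_logDensity (hh : IsKahler h) (hG : Continuous G)
    (hG0 : ∀ x, 0 < G x) (he : e ∈ atlas (Fin n → ℂ) X) {F : X → ℂ} {F' : (Fin n → ℂ) → ℂ}
    (hF : ContinuousOn F e.source) (hF0 : ∀ x ∉ e.source, F x = 0)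
    (hF' : ∀ y ∈ e.target, F (e.symm y) = F' y) (hF'0 : ∀ y ∉ e.target, F' y = 0) :
    ∫ x, (G x : ℂ) * F x ∂(volMeasure h) = ∫ y, Complex.exp (logDensity h G e y) * F' y := by
  rw [integral_volMeasure_eq hh he (F := fun x => (G x : ℂ) * F x)
    ((Complex.continuous_ofReal.comp hG).continuousOn.mul hF)
    fun x hx => by rw [hF0 x hx, mul_zero]]
  refine (setIntegral_congr_fun e.open_target.measurableSet fun y hy => ?_).trans
    (setIntegral_eq_integral_of_forall_compl_eq_zero fun y hy => by rw [hF'0 y hy, mul_zero])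
  simp only [hF' y hy, exp_logDensity hh.positive hG0 he hy, mul_assoc]

variable [CompactSpace X]

theorem integral_mul_vecDeriv_of_tsupport_subset (hh : IsKahler h) (hG : SmoothReal n G)
    (hG0 : ∀ x, 0 < G x) (hv : IsVectorField v) (hχ : SmoothComplex n χ)
    (he : e ∈ atlas (Fin n → ℂ) X) (hχe : tsupport χ ⊆ e.source) :
    ∫ x, (G x : ℂ) * vecDeriv v χ x ∂(volMeasure h)
      = -∫ x, (G x : ℂ) * (χ x * weightedDiv (logDensity h G e) (v e) (e x))
        ∂(volMeasure h) := by
  have htarget := tsupport_chartExtension_subset_target hχe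
  have hsource {x : X} (hx : x ∉ e.source) : x ∉ tsupport χ := fun h => hx (hχe h)
  have hdz {y : Fin n → ℂ} (hy : y ∉ e.target) (l : Fin n) : dz (chartExtension χ e) l y = 0 :=
    image_eq_zero_of_notMem_tsupport fun h => hy (htarget (tsupport_dz_subset h))
  have hleft : ∫ x, (G x : ℂ) * vecDeriv v χ x ∂(volMeasure h)
      = ∫ y, Complex.exp (logDensity h G e y)
        * (v e y ⬝ᵥ fun l => dz (chartExtension χ e) l y) := by
    refine integral_mul_eq_integral_exp_logDensity hh hG.continuous hG0 he
      (continuous_vecDeriv hv hχ).continuousOn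
      (fun x hx => vecDeriv_eq_zero_of_notMem_tsupport (hsource hx)) (fun y hy => ?_)
      (fun y hy => by simp only [hdz hy, dotProduct, mul_zero, Finset.sum_const_zero])
    simp only [vecDeriv_eq hv hχ he (e.map_target hy), e.right_inv hy,
      dz_congr (chartExtension_eventuallyEq hy)]
    rfl
  have hright : ∫ x, (G x : ℂ) * (χ x * weightedDiv (logDensity h G e) (v e) (e x))
        ∂(volMeasure h)
      = ∫ y, Complex.exp (logDensity h G e y)
        * (chartExtension χ e y * weightedDiv (logDensity h G e) (v e) y) := by
    refine integral_mul_eq_integral_exp_logDensity hh hG.continuous hG0 he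
      (hχ.continuous.continuousOn.mul (continuousOn_of_contDiffAt fun y hy =>
        contDiffAt_weightedDiv_logDensity hh hG hG0 hv he hy))
      (fun x hx => by rw [image_eq_zero_of_notMem_tsupport (hsource hx), zero_mul])
      (fun y hy => ?_)
      (fun y hy => by rw [image_eq_zero_of_notMem_tsupport fun h => hy (htarget h), zero_mul])
    rw [e.right_inv hy, (chartExtension_eventuallyEq hy).eq_of_nhds]
  rw [hleft, hright]
  exact integral_exp_mul_dotProduct_dz (contDiff_chartExtension hχ he hχe)
    (hasCompactSupport_chartExtension hχe)
    (fun y hy => (contDiffAt_logDensity hh hG hG0 he (htarget hy)).of_le (by simp))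
    (fun y hy => (hv.smooth e he y (htarget hy)).of_le (by simp))

theorem integrable_of_continuous (hh : IsKahler h) (hf : Continuous f) :
    Integrable f (volMeasure h) := by
  have := isFiniteMeasure_volMeasure hh
  exact hf.integrable_of_hasCompactSupport (HasCompactSupport.of_compactSpace f)

variable [T2Space X]

theorem eqOn_of_forall_integral_mul_eq (hh : IsKahler h) (hG : Continuous G)
    (hG0 : ∀ x, 0 < G x) {U : Set X} (hU : IsOpen U) {f g : X → ℂ} (hf : ContinuousOn f U)
    (hg : ContinuousOn g U)
    (hfg : ∀ χ : X → ℝ, SmoothReal n χ → tsupport (fun x => (χ x : ℂ)) ⊆ U →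
      ∫ x, (G x : ℂ) * (χ x * f x) ∂(volMeasure h)
        = ∫ x, (G x : ℂ) * (χ x * g x) ∂(volMeasure h)) : Set.EqOn f g U := by
  have := isManifold_real n X
  have := isFiniteMeasure_volMeasure hh
  have := isOpenPosMeasure_volMeasure hh
  have hGc : Continuous fun x => (G x : ℂ) := Complex.continuous_ofReal.comp hG
  have hint {χ : X → ℝ} (hχ : SmoothReal n χ) (hχU : tsupport (fun x => (χ x : ℂ)) ⊆ U)
      {f : X → ℂ} (hf : ContinuousOn f U) :
      Integrable (fun x => (G x : ℂ) * (χ x * f x)) (volMeasure h) := by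
    refine integrable_of_continuous hh (hGc.mul (continuous_of_tsupport fun x hx => ?_))
    exact (smoothComplex_ofReal hχ).continuous.continuousAt.mul
      (hf.continuousAt (hU.mem_nhds (hχU (tsupport_mul_subset_left hx))))
  have hc : ContinuousOn (fun x => (G x : ℂ) * (f x - g x)) U := hGc.continuousOn.mul (hf.sub hg)
  have hae : ∀ᵐ x ∂(volMeasure h), x ∈ U → (G x : ℂ) * (f x - g x) = 0 := by
    refine hU.ae_eq_zero_of_integral_contMDiff_smul_eq_zero 𝓘(ℝ, Fin n → ℂ)
      (hc.locallyIntegrableOn hU.measurableSet) fun χ hχ _ hχU => ?_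
    have hχU' : tsupport (fun x => (χ x : ℂ)) ⊆ U := by
      simpa [tsupport, Function.support] using hχU
    rw [← sub_eq_zero.2 (hfg χ hχ hχU'), ← integral_sub (hint hχ hχU' hf) (hint hχ hχU' hg)]
    refine integral_congr_ae (.of_forall fun x => ?_)
    simp only [Complex.real_smul]
    ring
  have hEq : Set.EqOn (fun x => (G x : ℂ) * (f x - g x)) 0 U := Measure.eqOn_open_of_ae_eq
    ((ae_restrict_iff' hU.measurableSet).2 hae) hU hc continuousOn_const
  exact fun x hx => sub_eq_zero.1
    ((mul_eq_zero.1 (hEq hx)).resolve_left (Complex.ofReal_ne_zero.2 (hG0 x).ne'))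

theorem divergence_eq (hh : IsKahler h) (hG : SmoothReal n G) (hG0 : ∀ x, 0 < G x)
    (hv : IsVectorField v) (he : e ∈ atlas (Fin n → ℂ) X) {x : X} (hx : x ∈ e.source) :
    divergence h G v x = weightedDiv (logDensity h G e) (v e) (e x) := by
  -- Both sides are the formal adjoint of `vecDeriv v`, so that they agree weakly; this avoids
  -- differentiating the Jacobian determinant of the change of coordinates.
  have hc := chart_mem_atlas (Fin n → ℂ) x
  have hcont {c : OpenPartialHomeomorph X (Fin n → ℂ)} (hc : c ∈ atlas (Fin n → ℂ) X) :
      ContinuousOn (fun x => weightedDiv (logDensity h G c) (v c) (c x)) c.source :=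
    continuousOn_of_contDiffAt fun y hy => contDiffAt_weightedDiv_logDensity hh hG hG0 hv hc hy
  refine eqOn_of_forall_integral_mul_eq hh hG.continuous hG0
    ((chartAt (Fin n → ℂ) x).open_source.inter e.open_source)
    ((hcont hc).mono Set.inter_subset_left) ((hcont he).mono Set.inter_subset_right)
    (fun χ hχ hχU => ?_) ⟨mem_chart_source _ x, hx⟩
  have hχ' := smoothComplex_ofReal hχ
  rw [← neg_inj, ← integral_mul_vecDeriv_of_tsupport_subset hh hG hG0 hv hχ' hc
    (hχU.trans Set.inter_subset_left), ← integral_mul_vecDeriv_of_tsupport_subset hh hG hG0 hv hχ'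
    he (hχU.trans Set.inter_subset_right)]

theorem continuous_divergence (hh : IsKahler h) (hG : SmoothReal n G) (hG0 : ∀ x, 0 < G x)
    (hv : IsVectorField v) : Continuous (divergence h G v) := by
  refine continuous_iff_continuousAt.2 fun x => ?_
  have hc := chart_mem_atlas (Fin n → ℂ) x
  exact ((continuousOn_of_contDiffAt fun y hy => contDiffAt_weightedDiv_logDensity hh hG hG0 hv hc
    hy).congr fun z hz => divergence_eq hh hG hG0 hv hc hz).continuousAt
    (chart_source_mem_nhds _ x)

theorem integral_mul_vecDeriv_mul_of_tsupport_subset (hh : IsKahler h) (hG : SmoothReal n G)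
    (hG0 : ∀ x, 0 < G x) (hv : IsVectorField v) {η : X → ℝ} (hη : SmoothReal n η)
    (hw : SmoothComplex n w) (he : e ∈ atlas (Fin n → ℂ) X) (hηe : tsupport η ⊆ e.source) :
    ∫ x, (G x : ℂ) * vecDeriv v (fun x => η x * w x) x ∂(volMeasure h)
      = -∫ x, (G x : ℂ) * (η x * w x * divergence h G v x) ∂(volMeasure h) := by
  have hsub : tsupport (fun x => η x * w x) ⊆ e.source :=
    tsupport_mul_subset_left.trans (by simpa [tsupport, Function.support] using hηe)
  rw [integral_mul_vecDeriv_of_tsupport_subset hh hG hG0 hv (smoothComplex_ofReal_mul hη hw) he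
    hsub]
  refine congrArg _ (integral_congr_ae (.of_forall fun x => ?_))
  by_cases hx : x ∈ e.source
  · simp only [divergence_eq hh hG hG0 hv he hx]
  · simp only [image_eq_zero_of_notMem_tsupport fun h => hx (hsub h), zero_mul, mul_zero]

theorem integral_mul_vecDeriv (hh : IsKahler h) (hG : SmoothReal n G) (hG0 : ∀ x, 0 < G x)
    (hv : IsVectorField v) (hw : SmoothComplex n w) :
    ∫ x, (G x : ℂ) * vecDeriv v w x ∂(volMeasure h)
      = -∫ x, (G x : ℂ) * (w x * divergence h G v x) ∂(volMeasure h) := by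
  obtain ⟨s, χ, hχ, hχ1, hχs⟩ := exists_finite_partition n X
  have hGc : Continuous fun x => (G x : ℂ) := Complex.continuous_ofReal.comp hG.continuous
  have hχw (a : X) : SmoothComplex n fun x => χ a x * w x := smoothComplex_ofReal_mul (hχ a) hw
  have hsum (x : X) : ∑ a ∈ s, (χ a x : ℂ) * w x = w x := by
    rw [← Finset.sum_mul, ← Complex.ofReal_sum, hχ1, Complex.ofReal_one, one_mul]
  have hint₁ (a : X) : Integrable (fun x => (G x : ℂ) * vecDeriv v (fun x => χ a x * w x) x)
      (volMeasure h) := integrable_of_continuous hh (hGc.mul (continuous_vecDeriv hv (hχw a)))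
  have hint₂ (a : X) : Integrable (fun x => (G x : ℂ) * (χ a x * w x * divergence h G v x))
      (volMeasure h) :=
    integrable_of_continuous hh
      (hGc.mul ((hχw a).continuous.mul (continuous_divergence hh hG hG0 hv)))
  calc ∫ x, (G x : ℂ) * vecDeriv v w x ∂(volMeasure h)
      = ∫ x, ∑ a ∈ s, (G x : ℂ) * vecDeriv v (fun x => χ a x * w x) x ∂(volMeasure h) := by
        simp only [← Finset.mul_sum, ← vecDeriv_sum fun a _ => hχw a, hsum]
    _ = ∑ a ∈ s, ∫ x, (G x : ℂ) * vecDeriv v (fun x => χ a x * w x) x ∂(volMeasure h) :=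
        integral_finsetSum _ fun a _ => hint₁ a
    _ = -∑ a ∈ s, ∫ x, (G x : ℂ) * (χ a x * w x * divergence h G v x) ∂(volMeasure h) := by
        rw [← Finset.sum_neg_distrib]
        exact Finset.sum_congr rfl fun a _ => integral_mul_vecDeriv_mul_of_tsupport_subset hh hG hG0
          hv (hχ a) hw (chart_mem_atlas _ a) (hχs a)
    _ = -∫ x, (G x : ℂ) * (w x * divergence h G v x) ∂(volMeasure h) := by
        rw [← integral_finsetSum _ fun a _ => hint₂ a]
        simp only [← Finset.mul_sum, ← Finset.sum_mul, hsum]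

theorem eq_divergence_grad (hh : IsKahler h) (hG : SmoothReal n G) (hG0 : ∀ x, 0 < G x)
    (hu : SmoothComplex n u) (hf : IsTwistedLaplacian h G u f) (hfc : Continuous f) :
    f = divergence h G (grad h u) := by
  have hv := isVectorField_grad hh hu
  refine funext fun x => eqOn_of_forall_integral_mul_eq hh hG.continuous hG0 isOpen_univ
    hfc.continuousOn (continuous_divergence hh hG hG0 hv).continuousOn (fun χ hχ _ => ?_)
    (Set.mem_univ x)
  have hadjoint := hf.2 _ (smoothComplex_ofReal hχ)
  simp only [inner01_mul_dbar_dbar, Complex.conj_ofReal] at hadjoint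
  rw [← neg_inj, ← integral_mul_vecDeriv hh hG hG0 hv (smoothComplex_ofReal hχ), ← hadjoint,
    ← integral_neg]
  refine integral_congr_ae (.of_forall fun x => ?_)
  ring

end Divergence

/-! ### The spectral gap -/

section SpectralGap

open MeasureTheory

variable {n : ℕ} {X : Type*} [TopologicalSpace X]

/-- The twisted Ricci form `-√-1 ∂∂̄ log (G hⁿ)` of the Kähler form `h` with the weight `G`, that
is, the Bakry-Émery Ricci form of the measure `G hⁿ`. -/
def twistedRicci (h : Form11 n X) (G : X → ℝ) : Form11 n X :=
  fun e y => -complexHessian (logDensity h G e) y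

variable [ChartedSpace (Fin n → ℂ) X] [MeasurableSpace X] {h : Form11 n X} {G : X → ℝ}
  {u f : X → ℂ} {c : ℂ}

theorem integral_mul_nonneg (hG0 : ∀ x, 0 < G x) (hf0 : ∀ x, 0 ≤ f x) :
    0 ≤ ∫ x, (G x : ℂ) * f x ∂(volMeasure h) :=
  integral_nonneg fun x => mul_nonneg (Complex.zero_le_real.2 (hG0 x).le) (hf0 x)

theorem neg_mul_integral_mul_conj (hu : SmoothComplex n u)
    (hc : IsTwistedLaplacian h G u fun x => c * u x) :
    -c * ∫ x, (G x : ℂ) * (u x * starRingEnd ℂ (u x)) ∂(volMeasure h)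
      = ∫ x, (G x : ℂ) * vecDeriv (grad h u) (fun x => starRingEnd ℂ (u x)) x
        ∂(volMeasure h) := by
  have hadjoint := hc.2 u hu
  simp only [inner01_mul_dbar_dbar] at hadjoint
  rw [← hadjoint, ← integral_const_mul]
  congr 1
  ext x
  ring

variable [IsManifold 𝓘(ℂ, Fin n → ℂ) ω X] [CompactSpace X] [BorelSpace X]

theorem integral_mul_pos (hh : IsKahler h) (hG : Continuous G) (hG0 : ∀ x, 0 < G x)
    (hf : Continuous f) (hf0 : ∀ x, 0 ≤ f x) (hne : f ≠ 0) :
    0 < ∫ x, (G x : ℂ) * f x ∂(volMeasure h) := by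
  have := isFiniteMeasure_volMeasure hh
  have := isOpenPosMeasure_volMeasure hh
  have hre (x : X) : f x = ((f x).re : ℂ) :=
    Complex.ext rfl (Complex.nonneg_iff.1 (hf0 x)).2.symm
  obtain ⟨x, hx⟩ := Function.ne_iff.1 hne
  have hpos : 0 < ∫ x, G x * (f x).re ∂(volMeasure h) := by
    refine Continuous.integral_pos_of_hasCompactSupport_nonneg_nonzero (x := x)
      (hG.mul (Complex.continuous_re.comp hf)) (HasCompactSupport.of_compactSpace _)
      (fun x => mul_nonneg (hG0 x).le (Complex.nonneg_iff.1 (hf0 x)).1)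
      (mul_ne_zero (hG0 x).ne' fun h => hx ?_)
    rw [hre, h, Complex.ofReal_zero, Pi.zero_apply]
  rw [integral_congr_ae (.of_forall fun x => congrArg _ (hre x))]
  simpa only [← Complex.ofReal_mul, integral_complex_ofReal, Complex.zero_lt_real] using hpos

theorem integral_mul_conj_pos (hh : IsKahler h) (hG : Continuous G) (hG0 : ∀ x, 0 < G x)
    (hu : Continuous u) (hu0 : u ≠ 0) :
    0 < ∫ x, (G x : ℂ) * (u x * starRingEnd ℂ (u x)) ∂(volMeasure h) := by
  refine integral_mul_pos hh hG hG0 (hu.mul (Complex.continuous_conj.comp hu))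
    (fun x => mul_star_self_nonneg (u x)) fun h => hu0 (funext fun x => ?_)
  simpa using congrFun h x

theorem nonpos_of_isEigenvalue (hh : IsKahler h) (hG : Continuous G) (hG0 : ∀ x, 0 < G x)
    (hc : IsEigenvalue h G c) : c ≤ 0 := by
  obtain ⟨u, hu, hu0, hcu⟩ := hc
  have hnorm := integral_mul_conj_pos hh hG hG0 hu.continuous hu0
  have henergy := integral_mul_nonneg (h := h) hG0 (vecDeriv_grad_conj_nonneg (u := u) hh.positive)
  rw [← neg_mul_integral_mul_conj hu hcu] at henergy
  exact neg_nonneg.1 (le_of_mul_le_mul_right (by rwa [zero_mul]) hnorm)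

variable [T2Space X]

theorem weightedDiv_conjDeriv_grad (hh : IsKahler h) (hG : SmoothReal n G) (hG0 : ∀ x, 0 < G x)
    (hu : SmoothComplex n u) (hc : IsTwistedLaplacian h G u fun x => c * u x)
    {e : OpenPartialHomeomorph X (Fin n → ℂ)} (he : e ∈ atlas (Fin n → ℂ) X) {y : Fin n → ℂ}
    (hy : y ∈ e.target) :
    weightedDiv (logDensity h G e) (conjDeriv (grad h u e)) y
      = c * (grad h u e y ⬝ᵥ (h e y *ᵥ star (grad h u e y)))
        + grad h u e y ⬝ᵥ (twistedRicci h G e y *ᵥ star (grad h u e y))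
        + (dbarMatrix (grad h u e) y * (dbarMatrix (grad h u e) y).map star).trace := by
  have hv := isVectorField_grad hh hu
  have hdiv : weightedDiv (logDensity h G e) (grad h u e) =ᶠ[𝓝 y] fun y => c * u (e.symm y) := by
    filter_upwards [e.open_target.mem_nhds hy] with y hy
    rw [congrFun (eq_divergence_grad hh hG hG0 hu hc (continuous_const.mul hu.continuous))
      (e.symm y), divergence_eq hh hG hG0 hv he (e.map_target hy), e.right_inv hy]
  have hdbar : (fun j => dzbar (weightedDiv (logDensity h G e) (grad h u e)) j y)
      = c • (grad h u e y ᵥ* h e y) := by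
    rw [grad_vecMul hh.positive he hy]
    exact funext fun j => (dzbar_congr hdiv).trans
      (dzbar_const_mul c ((contDiffAt_comp_symm hu he hy).differentiableAt (by simp)))
  rw [weightedDiv_conjDeriv ((contDiffAt_logDensity hh hG hG0 he hy).of_le (by norm_cast))
    ((hv.smooth e he y hy).of_le (by norm_cast)), hdbar, smul_dotProduct,
    ← Matrix.dotProduct_mulVec, twistedRicci, Matrix.neg_mulVec, dotProduct_neg, sub_eq_add_neg,
    smul_eq_mul]

theorem dotProduct_mulVec_le_weightedDiv_conjDeriv_grad (hh : IsKahler h) (hG : SmoothReal n G)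
    (hG0 : ∀ x, 0 < G x) (hu : SmoothComplex n u) {c t : ℝ} (hct : 0 ≤ c + t)
    (hc : IsTwistedLaplacian h G u fun x => c * u x)
    {e : OpenPartialHomeomorph X (Fin n → ℂ)} (he : e ∈ atlas (Fin n → ℂ) X) {y : Fin n → ℂ}
    (hy : y ∈ e.target) :
    grad h u e y ⬝ᵥ ((twistedRicci h G - t • h) e y *ᵥ star (grad h u e y))
      ≤ weightedDiv (logDensity h G e) (conjDeriv (grad h u e)) y := by
  have hnorm : 0 ≤ grad h u e y ⬝ᵥ (h e y *ᵥ star (grad h u e y)) := by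
    simpa only [star_star] using
      (hh.positive e he y hy).posSemidef.dotProduct_mulVec_nonneg (star (grad h u e y))
  have htrace := trace_mul_map_star_nonneg_of_isSymm (hh.positive e he y hy)
    (transpose_mul_dbarMatrix_grad_isSymm hh hu he hy)
  have hct' : (0 : ℂ) ≤ c + t := by exact_mod_cast hct
  rw [weightedDiv_conjDeriv_grad hh hG hG0 hu hc he hy, ← sub_nonneg]
  convert add_nonneg (mul_nonneg hct' hnorm) htrace using 1
  simp only [Pi.sub_apply, Pi.smul_apply, Matrix.sub_mulVec, Matrix.smul_mulVec, dotProduct_sub,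
    dotProduct_smul, Complex.real_smul]
  ring

theorem grad_eq_zero_of_nonneg_add (hh : IsKahler h) (hG : SmoothReal n G) (hG0 : ∀ x, 0 < G x)
    {t : ℝ} (hpos : IsPositive (twistedRicci h G - t • h)) (hu : SmoothComplex n u) {c : ℝ}
    (hct : 0 ≤ c + t) (hc : IsTwistedLaplacian h G u fun x => c * u x) (x : X) :
    grad h u (chartAt (Fin n → ℂ) x) (chartAt (Fin n → ℂ) x x) = 0 := by
  have hv := isVectorField_conjDeriv (isVectorField_grad hh hu)
  have hbochner (x : X) := dotProduct_mulVec_le_weightedDiv_conjDeriv_grad hh hG hG0 hu hct hc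
    (chart_mem_atlas (Fin n → ℂ) x) (mem_chart_target (Fin n → ℂ) x)
  have hnonneg (x : X) : 0 ≤ divergence h G (fun e => conjDeriv (grad h u e)) x := by
    refine le_trans ?_ (hbochner x)
    simpa only [star_star] using (hpos _ (chart_mem_atlas _ x) _
      (mem_chart_target _ x)).posSemidef.dotProduct_mulVec_nonneg (star (grad h u _ _))
  have hintegral : ∫ x, (G x : ℂ) * divergence h G (fun e => conjDeriv (grad h u e)) x
      ∂(volMeasure h) = 0 := by
    have hone := integral_mul_vecDeriv hh hG hG0 hv (w := fun _ => 1) contMDiff_const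
    simpa [vecDeriv_const] using hone
  have hzero : divergence h G (fun e => conjDeriv (grad h u e)) = 0 := by
    by_contra hne
    exact (integral_mul_pos hh hG.continuous hG0 (continuous_divergence hh hG hG0 hv) hnonneg
      hne).ne' hintegral
  by_contra hgrad
  have hlt := (hpos _ (chart_mem_atlas _ x) _ (mem_chart_target _ x)).dotProduct_mulVec_pos
    (star_ne_zero.2 hgrad)
  rw [star_star] at hlt
  exact (hlt.trans_le (hbochner x)).ne' (congrFun hzero x)

theorem add_neg_of_isEigenvalue (hh : IsKahler h) (hG : SmoothReal n G) (hG0 : ∀ x, 0 < G x)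
    {t : ℝ} (hpos : IsPositive (twistedRicci h G - t • h)) (hc : IsEigenvalue h G c)
    (hc0 : c ≠ 0) : c.im = 0 ∧ c.re + t < 0 := by
  have him : c.im = 0 := (Complex.nonpos_iff.1 (nonpos_of_isEigenvalue hh hG.continuous hG0 hc)).2
  obtain ⟨u, hu, hu0, hcu⟩ := hc
  refine ⟨him, not_le.1 fun hct => ?_⟩
  have hnorm := integral_mul_conj_pos hh hG.continuous hG0 hu.continuous hu0
  have henergy := neg_mul_integral_mul_conj hu hcu
  rw [← Complex.re_add_im c, him, Complex.ofReal_zero, zero_mul, add_zero] at hcu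
  have hgrad := grad_eq_zero_of_nonneg_add hh hG hG0 hpos hu hct hcu
  simp only [vecDeriv, hgrad, zero_dotProduct, mul_zero, integral_zero] at henergy
  exact mul_ne_zero (neg_ne_zero.2 hc0) hnorm.ne' henergy

end SpectralGap

/-! ### The Monge-Ampère equation -/

section MongeAmpere

variable {n : ℕ} {X : Type*} [TopologicalSpace X] [ChartedSpace (Fin n → ℂ) X]
  {h h₀ : Form11 n X} {G f : X → ℝ}

theorem pos_of_mul_volDensity_eq (hh : IsPositive h) (hh₀ : IsPositive h₀)
    (hGf : ∀ e ∈ atlas (Fin n → ℂ) X, ∀ x ∈ e.source,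
      G x * volDensity h e (e x) = Real.exp (f x) * volDensity h₀ e (e x)) (x : X) : 0 < G x := by
  have he := chart_mem_atlas (Fin n → ℂ) x
  have hy := mem_chart_target (Fin n → ℂ) x
  refine pos_of_mul_pos_left ?_ (volDensity_pos hh he hy).le
  rw [hGf _ he x (mem_chart_source _ x)]
  exact mul_pos (Real.exp_pos _) (volDensity_pos hh₀ he hy)

theorem logDensity_one_eventuallyEq (hh : IsPositive h) {e : OpenPartialHomeomorph X (Fin n → ℂ)}
    (he : e ∈ atlas (Fin n → ℂ) X) {y : Fin n → ℂ} (hy : y ∈ e.target) :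
    logDensity h (fun _ => 1) e =ᶠ[𝓝 y]
      fun y => Real.log (n.factorial * 2 ^ n) + Real.log (h e y).det.re := by
  filter_upwards [e.open_target.mem_nhds hy] with z hz
  have hdet : 0 < (h e z).det.re := (Complex.pos_iff.1 (hh e he z hz).det_pos).1
  rw [logDensity, one_mul, volDensity, Real.log_mul (by positivity) hdet.ne', Complex.ofReal_add]

theorem twistedRicci_one (hh : IsPositive h) {e : OpenPartialHomeomorph X (Fin n → ℂ)}
    (he : e ∈ atlas (Fin n → ℂ) X) {y : Fin n → ℂ} (hy : y ∈ e.target) :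
    twistedRicci h (fun _ => 1) e y = ricci h e y := by
  rw [twistedRicci, complexHessian_congr (logDensity_one_eventuallyEq hh he hy)]
  rw [complexHessian_const_add]
  ext i j
  rfl

theorem smoothReal_const_mul_add {φ ρ : X → ℝ} (hφ : SmoothReal n φ) (hρ : SmoothReal n ρ)
    (a : ℝ) : SmoothReal n fun x => a * φ x + ρ x :=
  (contMDiff_const.mul hφ).add hρ

variable [IsManifold 𝓘(ℂ, Fin n → ℂ) ω X]

theorem smoothReal_of_mul_volDensity_eq (hh : IsKahler h) (hh₀ : IsKahler h₀)
    (hf : SmoothReal n f)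
    (hGf : ∀ e ∈ atlas (Fin n → ℂ) X, ∀ x ∈ e.source,
      G x * volDensity h e (e x) = Real.exp (f x) * volDensity h₀ e (e x)) : SmoothReal n G := by
  have := isManifold_real n X
  intro x
  set e := chartAt (Fin n → ℂ) x
  have he : e ∈ atlas (Fin n → ℂ) X := chart_mem_atlas _ x
  have hy : e x ∈ e.target := mem_chart_target _ x
  have hratio : ContDiffAt ℝ ∞ (fun y => volDensity h₀ e y / volDensity h e y) (e x) :=
    (contDiffAt_volDensity hh₀ he hy).div (contDiffAt_volDensity hh he hy)
      (volDensity_pos hh.positive he hy).ne'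
  have hG : G =ᶠ[𝓝 x] fun z =>
      Real.exp (f z) * (volDensity h₀ e (e z) / volDensity h e (e z)) := by
    filter_upwards [e.open_source.mem_nhds (mem_chart_source _ x)] with z hz
    rw [← mul_div_assoc, ← hGf e he z hz,
      mul_div_cancel_right₀ _ (volDensity_pos hh.positive he (e.map_source hz)).ne']
  refine ContMDiffAt.congr_of_eventuallyEq ?_ hG
  exact (Real.contDiff_exp.contMDiff.contMDiffAt.comp x (hf x)).mul
    (hratio.contMDiffAt.comp x (contMDiffAt_of_mem_maximalAtlas
      (IsManifold.subset_maximalAtlas he) (mem_chart_source _ x)))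

theorem twistedRicci_of_mul_volDensity_eq (hh₀ : IsKahler h₀) (hf : SmoothReal n f)
    (hGf : ∀ e ∈ atlas (Fin n → ℂ) X, ∀ x ∈ e.source,
      G x * volDensity h e (e x) = Real.exp (f x) * volDensity h₀ e (e x))
    {e : OpenPartialHomeomorph X (Fin n → ℂ)} (he : e ∈ atlas (Fin n → ℂ) X) {y : Fin n → ℂ}
    (hy : y ∈ e.target) : twistedRicci h G e y = ricci h₀ e y - ddbar f e y := by
  have hlog : logDensity h G e =ᶠ[𝓝 y]
      fun z => (f (e.symm z) : ℂ) + logDensity h₀ (fun _ => 1) e z := by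
    filter_upwards [e.open_target.mem_nhds hy] with z hz
    have hGz := hGf e he (e.symm z) (e.map_target hz)
    rw [e.right_inv hz] at hGz
    rw [logDensity, logDensity, hGz, Real.log_mul (Real.exp_pos _).ne'
      (volDensity_pos hh₀.positive he hz).ne', Real.log_exp, one_mul, Complex.ofReal_add]
  rw [twistedRicci, complexHessian_congr hlog, complexHessian_add
    ((contDiffAt_comp_symm (smoothComplex_ofReal hf) he hy).of_le (by norm_cast))
    ((contDiffAt_logDensity hh₀ contMDiff_const (fun _ => one_pos) he hy).of_le (by norm_cast)),
    neg_add_rev, ← sub_eq_add_neg, ← twistedRicci_one hh₀.positive he hy]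
  rfl

theorem ddbar_const_mul_add {φ ρ : X → ℝ} (hφ : SmoothReal n φ) (hρ : SmoothReal n ρ) (a : ℝ)
    {e : OpenPartialHomeomorph X (Fin n → ℂ)} (he : e ∈ atlas (Fin n → ℂ) X) {y : Fin n → ℂ}
    (hy : y ∈ e.target) :
    ddbar (fun x => a * φ x + ρ x) e y = (a : ℂ) • ddbar φ e y + ddbar ρ e y := by
  have hφ' : ContDiffAt ℝ 2 (fun y => (φ (e.symm y) : ℂ)) y :=
    (contDiffAt_comp_symm (smoothComplex_ofReal hφ) he hy).of_le (by norm_cast)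
  have hρ' : ContDiffAt ℝ 2 (fun y => (ρ (e.symm y) : ℂ)) y :=
    (contDiffAt_comp_symm (smoothComplex_ofReal hρ) he hy).of_le (by norm_cast)
  change complexHessian (fun y => ((a * φ (e.symm y) + ρ (e.symm y) : ℝ) : ℂ)) y = _
  simp only [Complex.ofReal_add, Complex.ofReal_mul]
  rw [complexHessian_add (contDiffAt_const.mul hφ') hρ', complexHessian_const_mul _ hφ']
  rfl

theorem isPositive_twistedRicci_sub_smul {ω₀ : Form11 n X} {φ ρ₀ : X → ℝ} {t : ℝ}
    (hω₀ : IsKahler ω₀) (hφ : SmoothReal n φ) (hρ₀ : SmoothReal n ρ₀)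
    (hricci : ∀ e ∈ atlas (Fin n → ℂ) X, ∀ y ∈ e.target,
      ricci ω₀ e y - ω₀ e y = ddbar ρ₀ e y)
    (ht : t < 1) (hsol : SolvesContinuityEquation ω₀ ρ₀ t G φ) :
    IsPositive (twistedRicci (ω₀ + ddbar φ) G - t • (ω₀ + ddbar φ)) := by
  intro e he y hy
  have htwisted : twistedRicci (ω₀ + ddbar φ) G e y - t • (ω₀ e y + ddbar φ e y)
      = (1 - t) • ω₀ e y := by
    rw [twistedRicci_of_mul_volDensity_eq hω₀ (smoothReal_const_mul_add hφ hρ₀ (-t)) hsol he hy,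
      ddbar_const_mul_add hφ hρ₀ (-t) he hy, ← hricci e he y hy, Complex.coe_smul]
    module
  change Matrix.PosDef (twistedRicci (ω₀ + ddbar φ) G e y - t • (ω₀ e y + ddbar φ e y))
  rw [htwisted]
  exact (hω₀.positive e he y hy).smul (sub_pos.2 ht)

end MongeAmpere

end GSoliton

end

open GSoliton in
theorem proposition3p2_general {n : ℕ} {X : Type*} [TopologicalSpace X] [T2Space X]
    [CompactSpace X] [MeasurableSpace X] [BorelSpace X] [ChartedSpace (Fin n → ℂ) X]
    [IsManifold 𝓘(ℂ, Fin n → ℂ) ω X]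
    (ω₀ : Form11 n X) (hω₀ : IsKahler ω₀) (ρ₀ : X → ℝ) (hρ₀ : IsRicciPotential ω₀ ρ₀)
    (φ : X → ℝ) (hφ : SmoothReal n φ) (hpos : IsPositive (ω₀ + ddbar φ)) (G : X → ℝ)
    (t : ℝ) (ht : t < 1) (hsol : SolvesContinuityEquation ω₀ ρ₀ t G φ) :
    ∀ c : ℂ, IsEigenvalue (ω₀ + ddbar φ) G c → c ≠ 0 → c.im = 0 ∧ c.re + t < 0 := by
  intro c hc hc0
  have hω : IsKahler (ω₀ + ddbar φ) := isKahler_add_ddbar hω₀ hφ hpos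
  have hG : SmoothReal n G := smoothReal_of_mul_volDensity_eq hω hω₀
    (smoothReal_const_mul_add hφ hρ₀.smooth (-t)) hsol
  have hG0 : ∀ x, 0 < G x := pos_of_mul_volDensity_eq hpos hω₀.positive hsol
  have hricci : IsPositive (twistedRicci (ω₀ + ddbar φ) G - t • (ω₀ + ddbar φ)) :=
    isPositive_twistedRicci_sub_smul hω₀ hφ hρ₀.smooth hρ₀.eq ht hsol
  exact add_neg_of_isEigenvalue hω hG hG0 hricci hc hc0

open GSoliton in
theorem proposition3p2 {n r : ℕ} {X : Type*} [TopologicalSpace X] [T2Space X] [CompactSpace X]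
    [ConnectedSpace X] [MeasurableSpace X] [BorelSpace X] [ChartedSpace (Fin n → ℂ) X]
    [IsManifold 𝓘(ℂ, Fin n → ℂ) ω X]
    (T : Torus n r X) (hT : T.IsMaximal)
    (ω₀ : Form11 n X) (hω₀ : IsKahler ω₀) (hTω₀ : ∀ s, PreservedBy (T.act s) ω₀)
    (ρ₀ : X → ℝ) (hρ₀ : IsRicciPotential ω₀ ρ₀)
    (φ : X → ℝ) (hφ : IsKahlerPotential T ω₀ φ)
    (μ : X → Fin r → ℝ) (hμ : IsMomentMap T (ω₀ + ddbar φ) μ)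
    (g : (Fin r → ℝ) → ℝ) (hg : IsWeight (Set.range μ) g)
    (hg_norm : ∫ x, (g (μ x) - 1) ∂(volMeasure (ω₀ + ddbar φ)) = 0)
    (t : ℝ) (ht₀ : 0 < t) (ht₁ : t < 1)
    (hsol : SolvesContinuityEquation ω₀ ρ₀ t (fun x => g (μ x)) φ) :
    ∀ c : ℂ, IsEigenvalue (ω₀ + ddbar φ) (fun x => g (μ x)) c → c ≠ 0 →
      c.im = 0 ∧ c.re + t < 0 := fun c hc hc0 =>
  proposition3p2_general ω₀ hω₀ ρ₀ hρ₀ φ hφ.smooth hφ.positive _ t ht₁ hsol c hc hc0
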